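/- Notation. $\Delta^m=\{v\in\mathbb R^m_{\ge0}:\sum_i v_i=1\}$; $|A|$ is the entrywise absolute value of $A$; $\|A\|_\infty=\max_i\sum_j|A_{ij}|$; $\mathrm{nnz}(A)$ is the number of nonzero entries of $A$. Let $A\in\mathbb R^{m\times n}$, let $U\subseteq\mathbb R^n_{\ge 0}$ be convex, $\psi:U\to\mathbb R$ convex, and consider the constrained composite box-simplex game $\min_{u\in U}\max_{v\in\Delta^m} v^\top Au+\psi(u)$. Let $\epsilon>0$, let $R\ge\sup_{u\in U}\|u\|_\infty$ and let $\rho>0$ satisfy $\sup_{u\in U}\||A|u\|_\infty\le\rho\le n\|A\|_\infty$. Put $$\xi=\min\Bigl(1,\frac{\rho}{nm\|A\|_\infty}\Bigr),\qquad B=\log\max\Bigl(\frac1\xi,\,R+\xi\Bigr),\qquad \alpha=4\rho B,$$ and let $r$ be the doubly entropic regularizer $$r(u,v)=\sum_{i,j}(v_i+\xi)|A_{ij}|(u_j+\xi)\log(u_j+\xi)+\alpha\sum_i v_i\log v_i .$$ A $\delta_{\mathrm{BR}}$-approximate best response oracle for $(U,\psi,r)$ maps $v\in\Delta^m$, $h\in\mathbb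 R^n$ and $c\in[\frac12,1]$ to a point $\hat u\in U$ such that $\langle h+\nabla_U r(\hat u,v),\hat u-u\rangle\le c(\psi(u)-\psi(\hat u))+\delta_{\mathrm{BR}}$ for all $u\in U$, and $\|\nabla_V r(u^\star,v)-\nabla_V r(\hat u,v)\|_\infty\le\delta_{\mathrm{BR}}/2$ for a minimizer $u^\star$ of $\langle h,u\rangle+r(u,v)+c\,\psi(u)$ over $U$ (whose existence is part of the definition). There is one algorithm (a fixed program for a real-number machine with unit-cost $+,-,\times,/,\min,\max,\exp,\log$, whose input is $m,n,\rho,R,\epsilon$, which accesses $A$ only through products of $A,A^\top,|A|,|A|^\top$ with vectors, and $U,\psi$ only through the oracle) that, for all such data and every $\delta_{\mathrm{BR}}$-approximate best response oracle for $(U,\psi,r)$, outputs $\hat u\in U$, $\hat v\in\Delta^m$ with $$\langle v,A\hat u\rangle+\psi(\hat u)\le\langle\hat v,Au\rangle+\psi(u)+\epsilon\rho+6\delta_{\mathrm{BR}}\qquad\text{for all }u\in U,\ v\in\Delta^m .$$ All its oracle calls are made on $v\in\Delta^m$, $c\in[\frac12,1]$ and $\|h\|_\infty\le\max(mnB,\,2B+3)\,\|A\|_\infty$.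 It uses $\hat O(B\epsilon^{-1}+1)$ oracle calls, $\hat O(B\epsilon^{-1}+1)$ matrix-vector products, and $\hat O(\max(m,n)(B\epsilon^{-1}+1))$ other elementary operations (so a total time of $\hat O((\max(m,n)+\mathrm{nnz}(A))(B\epsilon^{-1}+1))$ besides the oracle). Here $\hat O$ hides a factor at most $C(1+\log m)(1+B)$ with an absolute constant $C$; and for every $K$ the hidden factor is at most $f_K(m)$ with $f_K(m)=m^{o(1)}$ on all instances with $n,\ R,\ \|A\|_\infty/\rho\le (m+1)^K$. -/

import Mathlib

open Matrix

noncomputable section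

namespace BoxSimplex

/-! ### Norms, regularizer, parameters -/

/-- The entrywise absolute value `|A|`. -/
def absM {m n : ℕ} (A : Matrix (Fin m) (Fin n) ℝ) : Matrix (Fin m) (Fin n) ℝ :=
  A.map (fun a => |a|)

/-- `‖A‖_∞ = max_i ∑_j |A i j|` (the norm on `Fin m → ℝ` is the sup norm). -/
def opNormInf {m n : ℕ} (A : Matrix (Fin m) (Fin n) ℝ) : ℝ :=
  ‖fun i : Fin m => ∑ j, |A i j|‖

/-- The doubly entropic regularizer
`∑_{i,j} (v_i + ξ) |A_ij| (u_j + ξ) log (u_j + ξ) + α ∑_i v_i log v_i`. -/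
def doublyEntropic {m n : ℕ} (A : Matrix (Fin m) (Fin n) ℝ) (α ξ : ℝ)
    (u : Fin n → ℝ) (v : Fin m → ℝ) : ℝ :=
  ∑ i, ∑ j, (v i + ξ) * |A i j| * ((u j + ξ) * Real.log (u j + ξ))
    + α * ∑ i, v i * Real.log (v i)

/-- `ξ = min (1, ρ / (n m ‖A‖_∞))`. -/
def xiParam {m n : ℕ} (A : Matrix (Fin m) (Fin n) ℝ) (ρ : ℝ) : ℝ :=
  min 1 (ρ / (n * m * opNormInf A))

/-- `B = log (max (1 / ξ, R + ξ))`. -/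
def logParam {m n : ℕ} (A : Matrix (Fin m) (Fin n) ℝ) (ρ R : ℝ) : ℝ :=
  Real.log (max (1 / xiParam A ρ) (R + xiParam A ρ))

/-! ### Approximate composite best response oracles -/

/-- The partial gradient `∇_U r (u, v)`. -/
def gradU {m n : ℕ} (r : (Fin n → ℝ) → (Fin m → ℝ) → ℝ) (u : Fin n → ℝ) (v : Fin m → ℝ) :
    Fin n → ℝ :=
  fun j => deriv (fun t => r (Function.update u j t) v) (u j)

/-- The partial gradient `∇_V r (u, v)`. -/
def gradV {m n : ℕ} (r : (Fin n → ℝ) → (Fin m → ℝ) → ℝ) (u : Fin n → ℝ) (v : Fin m → ℝ) :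
    Fin m → ℝ :=
  fun i => deriv (fun t => r u (Function.update v i t)) (v i)

/-- `O` is a `δ`-approximate composite best response oracle with respect to `(U, ψ, r)`: on a
point `v` of the simplex, a vector `h` and a constant `c ∈ [1/2, 1]` it returns a point of `U`
which satisfies the two conditions below, where `w` is a minimizer of
`⟨h, u⟩ + r (u, v) + c ψ (u)` over `U`. -/
def IsABRO {m n : ℕ} (U : Set (Fin n → ℝ)) (ψ : (Fin n → ℝ) → ℝ)
    (r : (Fin n → ℝ) → (Fin m → ℝ) → ℝ) (δ : ℝ)
    (O : (Fin m → ℝ) → (Fin n → ℝ) → ℝ → (Fin n → ℝ)) : Prop :=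
  ∀ v ∈ stdSimplex ℝ (Fin m), ∀ h : Fin n → ℝ, ∀ c ∈ Set.Icc (1 / 2 : ℝ) 1,
    O v h c ∈ U ∧
    (∀ u ∈ U, (h + gradU r (O v h c) v) ⬝ᵥ (O v h c - u) ≤ c * (ψ u - ψ (O v h c)) + δ) ∧
    ∃ w ∈ U, IsMinOn (fun u => h ⬝ᵥ u + r u v + c * ψ u) U w ∧
      ‖gradV r w v - gradV r (O v h c) v‖ ≤ δ / 2

/-! ### A real random access machine with access to the matrix and to an oracle

A program works on three banks of registers, holding scalars, vectors of `ℝ^n` and vectors of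
`ℝ^m`. It is a fixed piece of syntax that does not depend on `m`, `n` or on the instance. It
accesses `A` only by multiplying `A`, `Aᵀ`, `|A|`, `|A|ᵀ` with vectors; `U` and `ψ` only through
the oracle. -/

/-- Binary real operations. -/
inductive BinOp
  | add
  | sub
  | mul
  | div
  | max
  | min

/-- Unary real operations. -/
inductive UnOp
  | exp
  | log

def BinOp.app : BinOp → ℝ → ℝ → ℝ
  | .add, a, b => a + b
  | .sub, a, b => a - b
  | .mul, a, b => a * b
  | .div, a, b => a / b
  | .max, a, b => Max.max a b
  | .min, a, b => Min.min a b

def UnOp.app : UnOp → ℝ → ℝ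
  | .exp, a => Real.exp a
  | .log, a => Real.log a

/-- Programs. The first register argument `d` is the destination. The prefixes `s`, `x`, `y`
refer to scalars, vectors of `ℝ^n`, vectors of `ℝ^m`. -/
inductive Prog
  | seq (p q : Prog)
  /-- repeat `p` as often as the scalar register `k` says (rounded up) -/
  | loop (k : ℕ) (p : Prog)
  | sConst (d : ℕ) (q : ℚ)
  | sBin (f : BinOp) (d a b : ℕ)
  | sUn (f : UnOp) (d a : ℕ)
  /-- coordinatewise operations, constant vectors, sum and maximum of the coordinates -/
  | xBin (f : BinOp) (d a b : ℕ)
  | xUn (f : UnOp) (d a : ℕ)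
  | xFill (d a : ℕ)
  | xSum (d a : ℕ)
  | xMax (d a : ℕ)
  | yBin (f : BinOp) (d a b : ℕ)
  | yUn (f : UnOp) (d a : ℕ)
  | yFill (d a : ℕ)
  | ySum (d a : ℕ)
  | yMax (d a : ℕ)
  /-- products with `A`, `Aᵀ`, `|A|`, `|A|ᵀ` -/
  | mulA (d a : ℕ)
  | mulAT (d a : ℕ)
  | mulAbs (d a : ℕ)
  | mulAbsT (d a : ℕ)
  /-- the oracle call `x d := O (y v) (x h) (s c)` -/
  | call (d v h c : ℕ)

/-- The input of an oracle call. -/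
structure Query (m n : ℕ) where
  v : Fin m → ℝ
  h : Fin n → ℝ
  c : ℝ

/-- Contents of the registers, together with the number of elementary real operations carried
out so far, the number of matrix-vector products, and the list of all oracle queries. -/
structure Machine (m n : ℕ) where
  s : ℕ → ℝ
  x : ℕ → Fin n → ℝ
  y : ℕ → Fin m → ℝ
  arith : ℕ
  products : ℕ
  queries : List (Query m n)

namespace Machine

variable {m n : ℕ}

/-- Write a scalar, at the cost of `k` elementary operations. -/
def setS (σ : Machine m n) (d : ℕ) (a : ℝ) (k : ℕ) : Machine m n :=
  { σ with s := Function.update σ.s d a, arith := σ.arith + k }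

/-- Write a vector of `ℝ^n`, at the cost of `k` elementary operations. -/
def setX (σ : Machine m n) (d : ℕ) (a : Fin n → ℝ) (k : ℕ) : Machine m n :=
  { σ with x := Function.update σ.x d a, arith := σ.arith + k }

/-- Write a vector of `ℝ^m`, at the cost of `k` elementary operations. -/
def setY (σ : Machine m n) (d : ℕ) (a : Fin m → ℝ) (k : ℕ) : Machine m n :=
  { σ with y := Function.update σ.y d a, arith := σ.arith + k }

/-- Count `k` elementary operations. -/
def tick (σ : Machine m n) (k : ℕ) : Machine m n :=
  { σ with arith := σ.arith + k }

/-- Count a matrix-vector product. -/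
def countProduct (σ : Machine m n) : Machine m n :=
  { σ with products := σ.products + 1 }

/-- Record an oracle query. -/
def record (σ : Machine m n) (q : Query m n) : Machine m n :=
  { σ with queries := q :: σ.queries }

/-- The number of oracle calls. -/
def calls (σ : Machine m n) : ℕ := σ.queries.length

end Machine

/-- Running a program. -/
def Prog.run {m n : ℕ} (A : Matrix (Fin m) (Fin n) ℝ)
    (O : (Fin m → ℝ) → (Fin n → ℝ) → ℝ → (Fin n → ℝ)) : Prog → Machine m n → Machine m n
  | .seq p q, σ => q.run A O (p.run A O σ)
  | .loop k p, σ => (fun τ => (p.run A O τ).tick 1)^[⌈σ.s k⌉₊] (σ.tick 1)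
  | .sConst d q, σ => σ.setS d q 1
  | .sBin f d a b, σ => σ.setS d (f.app (σ.s a) (σ.s b)) 1
  | .sUn f d a, σ => σ.setS d (f.app (σ.s a)) 1
  | .xBin f d a b, σ => σ.setX d (fun j => f.app (σ.x a j) (σ.x b j)) n
  | .xUn f d a, σ => σ.setX d (fun j => f.app (σ.x a j)) n
  | .xFill d a, σ => σ.setX d (fun _ => σ.s a) n
  | .xSum d a, σ => σ.setS d (∑ j, σ.x a j) n
  | .xMax d a, σ => σ.setS d (⨆ j, σ.x a j) n
  | .yBin f d a b, σ => σ.setY d (fun i => f.app (σ.y a i) (σ.y b i)) m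
  | .yUn f d a, σ => σ.setY d (fun i => f.app (σ.y a i)) m
  | .yFill d a, σ => σ.setY d (fun _ => σ.s a) m
  | .ySum d a, σ => σ.setS d (∑ i, σ.y a i) m
  | .yMax d a, σ => σ.setS d (⨆ i, σ.y a i) m
  | .mulA d a, σ => (σ.setY d (A *ᵥ σ.x a) m).countProduct
  | .mulAT d a, σ => (σ.setX d (Aᵀ *ᵥ σ.y a) n).countProduct
  | .mulAbs d a, σ => (σ.setY d (absM A *ᵥ σ.x a) m).countProduct
  | .mulAbsT d a, σ => (σ.setX d ((absM A)ᵀ *ᵥ σ.y a) n).countProduct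
  | .call d v h c, σ =>
      (σ.setX d (O (σ.y v) (σ.x h) (σ.s c)) (m + n)).record ⟨σ.y v, σ.x h, σ.s c⟩

/-- The initial configuration: the scalar registers `0, …, 4` hold `m, n, ρ, R, ε`, everything
else is zero. -/
def initial (m n : ℕ) (ρ R ε : ℝ) : Machine m n where
  s := fun k => match k with
    | 0 => m
    | 1 => n
    | 2 => ρ
    | 3 => R
    | 4 => ε
    | _ => 0
  x := 0
  y := 0
  arith := 0
  products := 0
  queries := []

/-- At most `N` oracle calls, at most `N` matrix-vector products, and at most `max (m, n) N` other
elementary operations. -/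
def Machine.ResourcesLE {m n : ℕ} (σ : Machine m n) (N : ℝ) : Prop :=
  (σ.calls : ℝ) ≤ N ∧ (σ.products : ℝ) ≤ N ∧ (σ.arith : ℝ) ≤ max (m : ℝ) n * N

/-- `f m = m^{o(1)}`. -/
def IsSubpolynomial (f : ℕ → ℝ) : Prop :=
  ∀ θ : ℝ, 0 < θ → f =O[Filter.atTop] fun m : ℕ => (m : ℝ) ^ θ

end BoxSimplex

end

noncomputable section

namespace BoxSimplex

/-! ### The scalar Bregman divergence of `x log x` -/

theorem sq_sub_le_entropy {x y : ℝ} (hx : 0 ≤ x) (hy : 0 < y) :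
    (x - y) ^ 2 ≤ 2 * (x + y) * (x * Real.log x - x * Real.log y - x + y) := by
  have key : (√x - √y) ^ 2 ≤ x * Real.log x - x * Real.log y - x + y := by
    rcases hx.eq_or_lt with rfl | hx
    · simp [Real.sq_sqrt hy.le]
    · have h1 := Real.log_le_sub_one_of_pos (div_pos (Real.sqrt_pos.2 hy) (Real.sqrt_pos.2 hx))
      rw [Real.log_div (Real.sqrt_pos.2 hy).ne' (Real.sqrt_pos.2 hx).ne', Real.log_sqrt hx.le,
        Real.log_sqrt hy.le] at h1
      have h2 : x * (√y / √x) = √x * √y := by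
        have := (Real.sqrt_pos.2 hx).ne'
        field_simp
        rw [Real.sq_sqrt hx.le]
      have h3 := mul_le_mul_of_nonneg_left h1 hx.le
      nlinarith [Real.sq_sqrt hx.le, Real.sq_sqrt hy.le]
  have h4 : (x - y) ^ 2 = (√x - √y) ^ 2 * (√x + √y) ^ 2 := by
    have h5 : x - y = (√x - √y) * (√x + √y) := by
      nlinarith [Real.sq_sqrt hx, Real.sq_sqrt hy.le]
    rw [h5]; ring
  have h6 : (√x + √y) ^ 2 ≤ 2 * (x + y) := by
    nlinarith [Real.sq_sqrt hx, Real.sq_sqrt hy.le, sq_nonneg (√x - √y)]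
  calc (x - y) ^ 2 = (√x - √y) ^ 2 * (√x + √y) ^ 2 := h4
    _ ≤ (√x - √y) ^ 2 * (2 * (x + y)) := by gcongr
    _ ≤ _ := by
      rw [mul_comm]
      exact mul_le_mul_of_nonneg_left key (by positivity)

theorem entropy_ge {x y : ℝ} (hx : 0 ≤ x) (hy : 0 < y) :
    1 / 2 * ((x - y) ^ 2 / (x + y)) ≤ x * Real.log x - x * Real.log y - x + y := by
  have hs : 0 < x + y := by linarith
  have h := sq_sub_le_entropy hx hy
  have : (x - y) ^ 2 / (x + y) ≤ 2 * (x * Real.log x - x * Real.log y - x + y) := by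
    rw [div_le_iff₀ hs]; linarith
  linarith

theorem entropy_nonneg {x y : ℝ} (hx : 0 ≤ x) (hy : 0 < y) :
    0 ≤ x * Real.log x - x * Real.log y - x + y :=
  le_trans (by positivity) (entropy_ge hx hy)

theorem entropy_le {x y B : ℝ} (hx : 0 < x) (hy : 0 < y) (hxB : |Real.log x| ≤ B)
    (hyB : |Real.log y| ≤ B) :
    x * Real.log x - x * Real.log y - x + y ≤ 2 * B * |x - y| := by
  have h := entropy_nonneg hy.le hx
  have h1 : (x - y) * (Real.log x - Real.log y) ≤ |x - y| * (2 * B) := by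
    refine (le_abs_self _).trans ?_
    rw [abs_mul]
    refine mul_le_mul_of_nonneg_left ?_ (abs_nonneg _)
    exact (abs_sub _ _).trans (by linarith)
  linarith

theorem abs_mul_log_sub_le {x y B : ℝ} (hx : 0 < x) (hy : 0 < y) (hxB : |Real.log x| ≤ B)
    (hyB : |Real.log y| ≤ B) :
    |x * Real.log x - y * Real.log y| ≤ (1 + B) * |x - y| := by
  have h1 := entropy_nonneg hx.le hy
  have h2 := entropy_nonneg hy.le hx
  have aux : ∀ l : ℝ, |l| ≤ B → |(1 + l) * (x - y)| ≤ (1 + B) * |x - y| := by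
    intro l hl
    rw [abs_mul]
    refine mul_le_mul_of_nonneg_right ?_ (abs_nonneg _)
    exact (abs_add_le _ _).trans (by simpa using hl)
  have h3 := abs_le.1 (aux _ hxB)
  have h4 := abs_le.1 (aux _ hyB)
  rw [abs_le]
  constructor <;> linarith

theorem young_weighted {a b w s K : ℝ} (hw : 0 < w) (hs : 0 < s) :
    K * (|b| * |a|) ≤ 1 / 4 * (w * (a ^ 2 / s)) + K ^ 2 * (s * (b ^ 2 / w)) := by
  have h := sq_nonneg (|a| * w / 2 - K * |b| * s)
  have ha := sq_abs a
  have hb := sq_abs b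
  have : 1 / 4 * (w * (a ^ 2 / s)) + K ^ 2 * (s * (b ^ 2 / w)) - K * (|b| * |a|)
      = (|a| * w / 2 - K * |b| * s) ^ 2 / (w * s) := by
    rw [← ha, ← hb]
    field_simp
    ring
  have : 0 ≤ (|a| * w / 2 - K * |b| * s) ^ 2 / (w * s) := by positivity
  linarith

/-! ### Weighted cross terms -/

/-- The nonnegative bilinear form `∑ i j, |b i| |A i j| |a j|`. -/
def cross {m n : ℕ} (A : Matrix (Fin m) (Fin n) ℝ) (b : Fin m → ℝ) (a : Fin n → ℝ) : ℝ :=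
  ∑ i, ∑ j, |b i| * |A i j| * |a j|

theorem abs_sum_sum_le_cross {m n : ℕ} (A : Matrix (Fin m) (Fin n) ℝ) (b : Fin m → ℝ)
    (a : Fin n → ℝ) {K : ℝ} (F : Fin m → Fin n → ℝ)
    (hF : ∀ i j, |F i j| ≤ K * |A i j| * |a j|) :
    |∑ i, ∑ j, b i * F i j| ≤ K * cross A b a := by
  rw [cross, Finset.mul_sum]
  refine (Finset.abs_sum_le_sum_abs _ _).trans (Finset.sum_le_sum fun i _ => ?_)
  rw [Finset.mul_sum]
  refine (Finset.abs_sum_le_sum_abs _ _).trans (Finset.sum_le_sum fun j _ => ?_)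
  rw [abs_mul]
  have := mul_le_mul_of_nonneg_left (hF i j) (abs_nonneg (b i))
  linarith

theorem cross_le_young {m n : ℕ} (A : Matrix (Fin m) (Fin n) ℝ) (b w : Fin m → ℝ)
    (a s : Fin n → ℝ) {K M : ℝ} (hw : ∀ i, 0 < w i) (hs : ∀ j, 0 < s j)
    (hM : ∀ i, ∑ j, |A i j| * s j ≤ M) :
    K * cross A b a ≤ 1 / 4 * ∑ i, w i * ∑ j, |A i j| * (a j ^ 2 / s j)
      + K ^ 2 * M * ∑ i, b i ^ 2 / w i := by
  rw [cross, Finset.mul_sum, Finset.mul_sum, Finset.mul_sum, ← Finset.sum_add_distrib]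
  refine Finset.sum_le_sum fun i _ => ?_
  have h1 : K * ∑ j, |b i| * |A i j| * |a j| ≤
      ∑ j, |A i j| * (1 / 4 * (w i * (a j ^ 2 / s j)) + K ^ 2 * (s j * (b i ^ 2 / w i))) := by
    rw [Finset.mul_sum]
    refine Finset.sum_le_sum fun j _ => ?_
    have := mul_le_mul_of_nonneg_left (young_weighted (a := a j) (b := b i) (K := K) (hw i) (hs j))
      (abs_nonneg (A i j))
    linarith
  have h2 : ∑ j, |A i j| * (1 / 4 * (w i * (a j ^ 2 / s j)) + K ^ 2 * (s j * (b i ^ 2 / w i)))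
      = 1 / 4 * (w i * ∑ j, |A i j| * (a j ^ 2 / s j))
        + K ^ 2 * (∑ j, |A i j| * s j) * (b i ^ 2 / w i) := by
    simp only [Finset.mul_sum, Finset.sum_mul, ← Finset.sum_add_distrib]
    exact Finset.sum_congr rfl fun j _ => by ring
  have h3 : K ^ 2 * (∑ j, |A i j| * s j) * (b i ^ 2 / w i) ≤ K ^ 2 * M * (b i ^ 2 / w i) := by
    have := hw i
    have := hM i
    gcongr
  linarith

theorem cross_le_sum_abs {m n : ℕ} (A : Matrix (Fin m) (Fin n) ℝ) (b : Fin m → ℝ)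
    (a : Fin n → ℝ) {M : ℝ} (hM : ∀ i, ∑ j, |A i j| * |a j| ≤ M) :
    cross A b a ≤ M * ∑ i, |b i| := by
  rw [cross, Finset.mul_sum]
  refine Finset.sum_le_sum fun i _ => ?_
  have := mul_le_mul_of_nonneg_left (hM i) (abs_nonneg (b i))
  rw [Finset.mul_sum] at this
  simp only [← mul_assoc] at this
  linarith

/-! ### Normalized exponentials -/

/-- The normalized exponential. -/
def softmax {m : ℕ} (w : Fin m → ℝ) : Fin m → ℝ :=
  fun i => Real.exp (w i) / ∑ k, Real.exp (w k)

theorem sum_exp_pos {m : ℕ} [NeZero m] (w : Fin m → ℝ) : 0 < ∑ k, Real.exp (w k) :=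
  Finset.sum_pos (fun _ _ => Real.exp_pos _) Finset.univ_nonempty

theorem softmax_pos {m : ℕ} [NeZero m] (w : Fin m → ℝ) (i : Fin m) : 0 < softmax w i :=
  div_pos (Real.exp_pos _) (sum_exp_pos w)

theorem softmax_mem {m : ℕ} [NeZero m] (w : Fin m → ℝ) : softmax w ∈ stdSimplex ℝ (Fin m) :=
  ⟨fun i => (softmax_pos w i).le, by
    simp only [softmax, ← Finset.sum_div]
    exact div_self (sum_exp_pos w).ne'⟩

theorem log_softmax {m : ℕ} [NeZero m] (w : Fin m → ℝ) (i : Fin m) :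
    Real.log (softmax w i) = w i - Real.log (∑ k, Real.exp (w k)) := by
  rw [softmax, Real.log_div (Real.exp_pos _).ne' (sum_exp_pos w).ne', Real.log_exp]

/-- Two points of the simplex whose logarithms differ by a small vector up to a constant are
multiplicatively close. -/
theorem abs_log_sub_log_le {m : ℕ} [NeZero m] {v v' x : Fin m → ℝ} {c κ : ℝ}
    (hv : v ∈ stdSimplex ℝ (Fin m)) (hv' : v' ∈ stdSimplex ℝ (Fin m)) (hpos : ∀ i, 0 < v i)
    (hpos' : ∀ i, 0 < v' i) (hx : ∀ i, |x i| ≤ κ)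
    (h : ∀ i, Real.log (v' i) = Real.log (v i) + x i + c) (i : Fin m) :
    |Real.log (v' i) - Real.log (v i)| ≤ 2 * κ := by
  have hc : |c| ≤ κ := by
    rw [abs_le]
    constructor
    · by_contra hlt
      have : ∑ i, v' i < ∑ i, v i :=
        Finset.sum_lt_sum_of_nonempty Finset.univ_nonempty fun i _ =>
          (Real.log_lt_log_iff (hpos' i) (hpos i)).1 (by
            have := (abs_le.1 (hx i)).2
            linarith [h i])
      linarith [hv.2, hv'.2]
    · by_contra hlt
      have : ∑ i, v i < ∑ i, v' i :=
        Finset.sum_lt_sum_of_nonempty Finset.univ_nonempty fun i _ =>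
          (Real.log_lt_log_iff (hpos i) (hpos' i)).1 (by
            have := (abs_le.1 (hx i)).1
            linarith [h i])
      linarith [hv.2, hv'.2]
  rw [h i, show Real.log (v i) + x i + c - Real.log (v i) = x i + c by ring]
  exact (abs_add_le _ _).trans (by linarith [hx i])

theorem le_two_mul_of_log_sub_le {x y : ℝ} (hx : 0 < x) (hy : 0 < y)
    (h : |Real.log x - Real.log y| ≤ 1 / 2) : x ≤ 2 * y := by
  have h2 : (1 : ℝ) / 2 ≤ Real.log 2 := by linarith [Real.log_two_gt_d9]
  rw [← Real.log_le_log_iff hx (by positivity), Real.log_mul two_ne_zero hy.ne']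
  linarith [(abs_le.1 h).2]

/-! ### The optimistic proximal iteration -/

/-- The bounds on the data that the analysis of the iteration uses. -/
structure Bounds {m n : ℕ} (A : Matrix (Fin m) (Fin n) ℝ) (U : Set (Fin n → ℝ)) (ρ ξ B : ℝ) :
    Prop where
  rho_pos : 0 < ρ
  xi_pos : 0 < ξ
  nonneg_B : 0 ≤ B
  card_mul_xi : m * ξ ≤ 1
  xi_row : ∀ i, ∑ j, |A i j| * ξ ≤ ρ
  nonneg : ∀ u ∈ U, ∀ j, 0 ≤ u j
  row : ∀ u ∈ U, ∀ i, ∑ j, |A i j| * u j ≤ ρ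
  abs_log : ∀ u ∈ U, ∀ j, |Real.log (u j + ξ)| ≤ B
  log_card : Real.log m ≤ B

/-- The vector `(u_j + ξ) log (u_j + ξ)`. -/
def phi {n : ℕ} (ξ : ℝ) (u : Fin n → ℝ) : Fin n → ℝ :=
  fun j => (u j + ξ) * Real.log (u j + ξ)

/-- The closed form of `∇_U r (u, v)` for the doubly entropic regularizer. -/
def entropicGrad {m n : ℕ} (A : Matrix (Fin m) (Fin n) ℝ) (ξ : ℝ) (u : Fin n → ℝ)
    (v : Fin m → ℝ) : Fin n → ℝ :=
  fun j => ((absM A)ᵀ *ᵥ fun i => v i + ξ) j * (1 + Real.log (u j + ξ))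

/-- The state of the iteration: the previous and the current primal point, the current dual point,
and the accumulated dual gradient. -/
structure State (m n : ℕ) where
  uprev : Fin n → ℝ
  u : Fin n → ℝ
  v : Fin m → ℝ
  S : Fin m → ℝ

/-- The dual point after a step. -/
def State.nextV {m n : ℕ} (A : Matrix (Fin m) (Fin n) ℝ) (a ξ : ℝ) (st : State m n) :
    Fin m → ℝ :=
  softmax fun i => (st.S i + ((A *ᵥ st.u) i - (absM A *ᵥ phi ξ st.u) i)) / a

/-- The linear term of the oracle query of a step. -/
def State.nextH {m n : ℕ} (A : Matrix (Fin m) (Fin n) ℝ) (a ξ : ℝ) (st : State m n) :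
    Fin n → ℝ :=
  Aᵀ *ᵥ st.nextV A a ξ - entropicGrad A ξ st.u st.v

/-- One step of the iteration. -/
def State.next {m n : ℕ} (A : Matrix (Fin m) (Fin n) ℝ)
    (O : (Fin m → ℝ) → (Fin n → ℝ) → ℝ → (Fin n → ℝ)) (a ξ : ℝ) (st : State m n) : State m n where
  uprev := st.u
  u := O (st.nextV A a ξ) (st.nextH A a ξ) 1
  v := st.nextV A a ξ
  S := st.S + A *ᵥ O (st.nextV A a ξ) (st.nextH A a ξ) 1

/-- The initial state. -/
def State.start {m n : ℕ} (A : Matrix (Fin m) (Fin n) ℝ)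
    (O : (Fin m → ℝ) → (Fin n → ℝ) → ℝ → (Fin n → ℝ)) (ξ : ℝ) : State m n where
  uprev := O (fun _ => 1 / (m : ℝ)) 0 1
  u := O (fun _ => 1 / (m : ℝ)) 0 1
  v := fun _ => 1 / (m : ℝ)
  S := absM A *ᵥ phi ξ (O (fun _ => 1 / (m : ℝ)) 0 1)

/-- The invariant of the iteration: the accumulated gradient is, up to a constant vector, an
outdated version of `∇_V r`. -/
structure State.Valid {m n : ℕ} (A : Matrix (Fin m) (Fin n) ℝ) (U : Set (Fin n → ℝ)) (a ξ : ℝ)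
    (st : State m n) : Prop where
  uprev_mem : st.uprev ∈ U
  u_mem : st.u ∈ U
  v_mem : st.v ∈ stdSimplex ℝ (Fin m)
  v_pos : ∀ i, 0 < st.v i
  dual : ∃ c, ∀ i, st.S i = a * Real.log (st.v i) + ∑ j, |A i j| * phi ξ st.uprev j
    + ∑ j, A i j * (st.u j - st.uprev j) + c

/-- The divergence from a state, with the accumulated gradient in place of `∇_V r`. -/
def State.div {m n : ℕ} (A : Matrix (Fin m) (Fin n) ℝ) (a ξ : ℝ) (st : State m n)
    (u : Fin n → ℝ) (v : Fin m → ℝ) : ℝ :=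
  doublyEntropic A a ξ u v - doublyEntropic A a ξ st.u st.v
    - entropicGrad A ξ st.u st.v ⬝ᵥ (u - st.u) - st.S ⬝ᵥ (v - st.v)

/-- The weighted size of the last primal movement. -/
def State.move {m n : ℕ} (A : Matrix (Fin m) (Fin n) ℝ) (ξ : ℝ) (st : State m n) : ℝ :=
  ∑ i, st.v i * ∑ j, |A i j| * ((st.u j - st.uprev j) ^ 2 / ((st.u j + ξ) + (st.uprev j + ξ)))

theorem gradU_doublyEntropic {m n : ℕ} (A : Matrix (Fin m) (Fin n) ℝ) (α ξ : ℝ)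
    (u : Fin n → ℝ) (v : Fin m → ℝ) (hu : ∀ j, u j + ξ ≠ 0) :
    gradU (doublyEntropic A α ξ) u v = entropicGrad A ξ u v := by
  funext j
  refine HasDerivAt.deriv ?_
  have hφ : HasDerivAt (fun t : ℝ => (t + ξ) * Real.log (t + ξ)) (1 + Real.log (u j + ξ)) (u j) := by
    have h1 : HasDerivAt (fun t : ℝ => t + ξ) 1 (u j) := (hasDerivAt_id _).add_const _
    have h2 := h1.mul (h1.log (hu j))
    refine h2.congr_deriv ?_
    have := hu j
    field_simp
    ring
  have hterm : ∀ i k, HasDerivAt (fun t : ℝ => (v i + ξ) * |A i k| *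
      ((Function.update u j t k + ξ) * Real.log (Function.update u j t k + ξ)))
      (if k = j then (v i + ξ) * |A i j| * (1 + Real.log (u j + ξ)) else 0) (u j) := by
    intro i k
    by_cases hk : k = j
    · subst hk
      simpa using hφ.const_mul ((v i + ξ) * |A i k|)
    · simp only [Function.update_of_ne hk, if_neg hk]
      exact hasDerivAt_const _ _
  have hsum := (HasDerivAt.fun_sum (u := Finset.univ) fun i _ =>
    HasDerivAt.fun_sum (u := Finset.univ) fun k _ => hterm i k).add_const
      (α * ∑ i, v i * Real.log (v i))
  refine hsum.congr_deriv ?_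
  simp only [Finset.sum_ite_eq', Finset.mem_univ, if_true, entropicGrad, mulVec, dotProduct,
    transpose_apply, absM, map_apply, Finset.sum_mul]
  exact Finset.sum_congr rfl fun i _ => by ring

theorem entropicGrad_dotProduct {m n : ℕ} (A : Matrix (Fin m) (Fin n) ℝ) (ξ : ℝ)
    (u : Fin n → ℝ) (v : Fin m → ℝ) (x : Fin n → ℝ) :
    entropicGrad A ξ u v ⬝ᵥ x
      = ∑ i, ∑ j, (v i + ξ) * |A i j| * ((1 + Real.log (u j + ξ)) * x j) := by
  rw [Finset.sum_comm]
  simp only [dotProduct, entropicGrad, mulVec, transpose_apply, absM, map_apply, Finset.sum_mul]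
  exact Finset.sum_congr rfl fun j _ => Finset.sum_congr rfl fun i _ => by ring

theorem State.Valid.div_eq {m n : ℕ} {A : Matrix (Fin m) (Fin n) ℝ} {U : Set (Fin n → ℝ)}
    {a ξ : ℝ} {st : State m n} (h : st.Valid A U a ξ) (u : Fin n → ℝ) {v : Fin m → ℝ}
    (hv : v ∈ stdSimplex ℝ (Fin m)) :
    st.div A a ξ u v =
      ∑ i, ∑ j, (v i + ξ) * |A i j| * ((u j + ξ) * Real.log (u j + ξ)
        - (u j + ξ) * Real.log (st.u j + ξ) - (u j + ξ) + (st.u j + ξ))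
      + ∑ i, ∑ j, (v i - st.v i) * (|A i j| * (1 + Real.log (st.u j + ξ)) * (u j - st.u j))
      + a * ∑ i, (v i * Real.log (v i) - v i * Real.log (st.v i) - v i + st.v i)
      - ∑ i, ∑ j, (v i - st.v i) * (A i j * (st.u j - st.uprev j)
        - |A i j| * (phi ξ st.u j - phi ξ st.uprev j)) := by
  obtain ⟨c, hc⟩ := h.dual
  have hi : ∀ i, ∑ j, (v i + ξ) * |A i j| * ((u j + ξ) * Real.log (u j + ξ))
      - ∑ j, (st.v i + ξ) * |A i j| * ((st.u j + ξ) * Real.log (st.u j + ξ))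
      - ∑ j, (st.v i + ξ) * |A i j| * ((1 + Real.log (st.u j + ξ)) * (u j - st.u j))
      - (∑ j, |A i j| * phi ξ st.uprev j + ∑ j, A i j * (st.u j - st.uprev j)) * (v i - st.v i)
      = ∑ j, (v i + ξ) * |A i j| * ((u j + ξ) * Real.log (u j + ξ)
        - (u j + ξ) * Real.log (st.u j + ξ) - (u j + ξ) + (st.u j + ξ))
      + ∑ j, (v i - st.v i) * (|A i j| * (1 + Real.log (st.u j + ξ)) * (u j - st.u j))
      - ∑ j, (v i - st.v i) * (A i j * (st.u j - st.uprev j)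
        - |A i j| * (phi ξ st.u j - phi ξ st.uprev j)) := by
    intro i
    simp only [Finset.sum_mul, ← Finset.sum_add_distrib,
      ← Finset.sum_sub_distrib, phi]
    exact Finset.sum_congr rfl fun j _ => by ring
  have hsum := Finset.sum_congr (rfl : (Finset.univ : Finset (Fin m)) = _) fun i _ => hi i
  simp only [Finset.sum_sub_distrib, Finset.sum_add_distrib] at hsum
  have hS : st.S ⬝ᵥ (v - st.v) = a * ∑ i, Real.log (st.v i) * (v i - st.v i)
      + ∑ i, (∑ j, |A i j| * phi ξ st.uprev j + ∑ j, A i j * (st.u j - st.uprev j))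
        * (v i - st.v i) := by
    have h0 : ∑ i, c * (v i - st.v i) = 0 := by
      rw [← Finset.mul_sum, Finset.sum_sub_distrib, hv.2, h.v_mem.2]; ring
    rw [← add_zero (a * _ + _), ← h0, Finset.mul_sum, ← Finset.sum_add_distrib,
      ← Finset.sum_add_distrib]
    exact Finset.sum_congr rfl fun i _ => by rw [hc i, Pi.sub_apply]; ring
  have hent : ∑ i, (v i * Real.log (v i) - v i * Real.log (st.v i) - v i + st.v i)
      = ∑ i, v i * Real.log (v i) - ∑ i, st.v i * Real.log (st.v i)
        - ∑ i, Real.log (st.v i) * (v i - st.v i) := by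
    have h1 : ∑ i, (st.v i - v i) = 0 := by
      rw [Finset.sum_sub_distrib, hv.2, h.v_mem.2]; ring
    rw [← add_zero (_ - _ - _), ← h1, ← Finset.sum_sub_distrib, ← Finset.sum_sub_distrib,
      ← Finset.sum_add_distrib]
    exact Finset.sum_congr rfl fun i _ => by ring
  rw [State.div, entropicGrad_dotProduct, hS, hent, doublyEntropic, doublyEntropic]
  simp only [Pi.sub_apply]
  linear_combination hsum

namespace Bounds

variable {m n : ℕ} {A : Matrix (Fin m) (Fin n) ℝ} {U : Set (Fin n → ℝ)} {ρ ξ B : ℝ}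

theorem add_xi_pos (hb : Bounds A U ρ ξ B) {u : Fin n → ℝ} (hu : u ∈ U) (j : Fin n) :
    0 < u j + ξ := by
  linarith [hb.nonneg u hu j, hb.xi_pos]

theorem row_add (hb : Bounds A U ρ ξ B) {u u' : Fin n → ℝ} (hu : u ∈ U) (hu' : u' ∈ U)
    (i : Fin m) : ∑ j, |A i j| * ((u j + ξ) + (u' j + ξ)) ≤ 4 * ρ := by
  simp only [mul_add, Finset.sum_add_distrib]
  linarith [hb.row u hu i, hb.row u' hu' i, hb.xi_row i]

theorem row_abs_sub (hb : Bounds A U ρ ξ B) {u u' : Fin n → ℝ} (hu : u ∈ U) (hu' : u' ∈ U)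
    (i : Fin m) : ∑ j, |A i j| * |u j - u' j| ≤ 2 * ρ := by
  have : ∑ j, |A i j| * |u j - u' j| ≤ ∑ j, |A i j| * (u j + u' j) := by
    refine Finset.sum_le_sum fun j _ => mul_le_mul_of_nonneg_left ?_ (abs_nonneg _)
    have := hb.nonneg u hu j
    have := hb.nonneg u' hu' j
    rw [abs_le]
    constructor <;> linarith
  simp only [mul_add, Finset.sum_add_distrib] at this
  linarith [hb.row u hu i, hb.row u' hu' i]

theorem abs_one_add_log (hb : Bounds A U ρ ξ B) {u : Fin n → ℝ} (hu : u ∈ U) (j : Fin n) :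
    |1 + Real.log (u j + ξ)| ≤ 1 + B :=
  (abs_add_le _ _).trans (by simpa using hb.abs_log u hu j)

theorem abs_phi_sub (hb : Bounds A U ρ ξ B) {u u' : Fin n → ℝ} (hu : u ∈ U) (hu' : u' ∈ U)
    (j : Fin n) : |phi ξ u j - phi ξ u' j| ≤ (1 + B) * |u j - u' j| := by
  have := abs_mul_log_sub_le (hb.add_xi_pos hu j) (hb.add_xi_pos hu' j) (hb.abs_log u hu j)
    (hb.abs_log u' hu' j)
  simpa [phi] using this

theorem abs_curvature_le (hb : Bounds A U ρ ξ B) {u : Fin n → ℝ} (hu : u ∈ U) (u' : Fin n → ℝ)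
    (v v' : Fin m → ℝ) :
    |∑ i, ∑ j, (v i - v' i) * (|A i j| * (1 + Real.log (u j + ξ)) * (u' j - u j))|
      ≤ (1 + B) * cross A (v - v') (u' - u) := by
  refine abs_sum_sum_le_cross A (v - v') (u' - u) _ fun i j => ?_
  rw [abs_mul, abs_mul, abs_abs, Pi.sub_apply]
  have := mul_le_mul_of_nonneg_left (hb.abs_one_add_log hu j) (abs_nonneg (A i j))
  exact mul_le_mul_of_nonneg_right (by linarith) (abs_nonneg _)

theorem abs_lag_le (hb : Bounds A U ρ ξ B) {u u' : Fin n → ℝ} (hu : u ∈ U) (hu' : u' ∈ U)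
    (v v' : Fin m → ℝ) :
    |∑ i, ∑ j, (v i - v' i) * (A i j * (u j - u' j) - |A i j| * (phi ξ u j - phi ξ u' j))|
      ≤ 2 * (1 + B) * cross A (v - v') (u - u') := by
  refine abs_sum_sum_le_cross A (v - v') (u - u') _ fun i j => ?_
  refine (abs_sub _ _).trans ?_
  rw [abs_mul, abs_mul, abs_abs, Pi.sub_apply]
  have h1 := mul_le_mul_of_nonneg_left (hb.abs_phi_sub hu hu' j) (abs_nonneg (A i j))
  have h2 : 0 ≤ B * (|A i j| * |u j - u' j|) := mul_nonneg hb.nonneg_B (by positivity)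
  linarith

theorem cross_le (hb : Bounds A U ρ ξ B) {u u' : Fin n → ℝ} (hu : u ∈ U) (hu' : u' ∈ U)
    (b : Fin m → ℝ) : cross A b (u - u') ≤ 2 * ρ * ∑ i, |b i| :=
  cross_le_sum_abs A b _ fun i => hb.row_abs_sub hu hu' i

/-- On the simplex, `(1 + B) ‖v - v'‖₁ ≤ 5 B`: either there is only one point, or `B ≥ log 2`. -/
theorem one_add_mul_sum_abs_sub_le (hb : Bounds A U ρ ξ B) {v v' : Fin m → ℝ}
    (hv : v ∈ stdSimplex ℝ (Fin m)) (hv' : v' ∈ stdSimplex ℝ (Fin m)) :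
    (1 + B) * ∑ i, |v i - v' i| ≤ 5 * B := by
  have hB := hb.nonneg_B
  rcases Nat.lt_or_ge m 2 with hm | hm
  · have : ∑ i, |v i - v' i| = 0 := by
      have h1 := hv.2
      have h2 := hv'.2
      interval_cases m
      · simp
      · simp only [Finset.univ_unique, Finset.sum_singleton] at h1 h2 ⊢
        rw [h1, h2]; simp
    rw [this]; linarith
  · have h2 : Real.log 2 ≤ B :=
      (Real.log_le_log two_pos (by exact_mod_cast hm)).trans hb.log_card
    have h3 : ∑ i, |v i - v' i| ≤ 2 := by
      have : ∑ i, |v i - v' i| ≤ ∑ i, (v i + v' i) := by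
        refine Finset.sum_le_sum fun i _ => ?_
        have := hv.1 i
        have := hv'.1 i
        rw [abs_le]
        constructor <;> linarith
      rw [Finset.sum_add_distrib, hv.2, hv'.2] at this
      linarith
    have := mul_le_mul_of_nonneg_left h3 (by linarith : 0 ≤ 1 + B)
    linarith [Real.log_two_gt_d9]

theorem sq_one_add_mul_log_le (hb : Bounds A U ρ ξ B) :
    (1 + B) ^ 2 * Real.log m ≤ 5 / 2 * (B * (1 + B) * Real.log m) := by
  have hB := hb.nonneg_B
  rcases Nat.lt_or_ge m 2 with hm | hm
  · have : Real.log m = 0 := by interval_cases m <;> simp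
    rw [this]; simp
  · have h2 : Real.log 2 ≤ Real.log m := Real.log_le_log two_pos (by exact_mod_cast hm)
    have h3 : 1 + B ≤ 5 / 2 * B := by linarith [Real.log_two_gt_d9, hb.log_card]
    have h4 : 0 ≤ (1 + B) * Real.log m := by
      have := Real.log_two_gt_d9
      exact mul_nonneg (by linarith) (by linarith)
    nlinarith [mul_le_mul_of_nonneg_right h3 h4]

end Bounds

/-- The properties of the oracle, for the coefficient `1`, that the iteration uses. -/
def BestResponds {m n : ℕ} (A : Matrix (Fin m) (Fin n) ℝ) (U : Set (Fin n → ℝ))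
    (ψ : (Fin n → ℝ) → ℝ) (ξ δ : ℝ)
    (O : (Fin m → ℝ) → (Fin n → ℝ) → ℝ → (Fin n → ℝ)) : Prop :=
  ∀ v ∈ stdSimplex ℝ (Fin m), ∀ h : Fin n → ℝ, O v h 1 ∈ U ∧
    ∀ u ∈ U, (h + entropicGrad A ξ (O v h 1) v) ⬝ᵥ (O v h 1 - u) ≤ ψ u - ψ (O v h 1) + δ

namespace State

variable {m n : ℕ} {A : Matrix (Fin m) (Fin n) ℝ} {U : Set (Fin n → ℝ)} {ψ : (Fin n → ℝ) → ℝ}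
  {ρ ξ B a δ : ℝ} {O : (Fin m → ℝ) → (Fin n → ℝ) → ℝ → (Fin n → ℝ)} {st : State m n}

theorem uniform_mem [NeZero m] : (fun _ : Fin m => 1 / (m : ℝ)) ∈ stdSimplex ℝ (Fin m) :=
  ⟨fun _ => by positivity, by simp [NeZero.ne m]⟩

theorem valid_start [NeZero m] (hO : BestResponds A U ψ ξ δ O) :
    (start A O ξ).Valid A U a ξ where
  uprev_mem := (hO _ uniform_mem 0).1
  u_mem := (hO _ uniform_mem 0).1
  v_mem := uniform_mem
  v_pos := fun i => by
    have : 0 < m := Nat.pos_of_ne_zero (NeZero.ne m)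
    simp only [start]
    positivity
  dual := ⟨-(a * Real.log (1 / m)), fun i => by
    simp [start, mulVec, dotProduct, absM]⟩

theorem log_next_v [NeZero m] (i : Fin m) :
    Real.log ((st.next A O a ξ).v i)
      = (st.S i + ((A *ᵥ st.u) i - (absM A *ᵥ phi ξ st.u) i)) / a - Real.log (∑ k, Real.exp
        ((st.S k + ((A *ᵥ st.u) k - (absM A *ᵥ phi ξ st.u) k)) / a)) :=
  log_softmax (fun i => (st.S i + ((A *ᵥ st.u) i - (absM A *ᵥ phi ξ st.u) i)) / a) i

theorem Valid.next [NeZero m] (hO : BestResponds A U ψ ξ δ O) (ha : a ≠ 0)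
    (h : st.Valid A U a ξ) : (st.next A O a ξ).Valid A U a ξ where
  uprev_mem := h.u_mem
  u_mem := (hO _ (softmax_mem _) _).1
  v_mem := softmax_mem _
  v_pos := softmax_pos _
  dual := by
    refine ⟨a * Real.log (∑ k, Real.exp
      ((st.S k + ((A *ᵥ st.u) k - (absM A *ᵥ phi ξ st.u) k)) / a)), fun i => ?_⟩
    have h1 : (st.next A O a ξ).S i = st.S i + (A *ᵥ (st.next A O a ξ).u) i := rfl
    have h2 : (st.next A O a ξ).uprev = st.u := rfl
    have h3 : ∑ j, A i j * ((st.next A O a ξ).u j - st.u j)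
        = (A *ᵥ (st.next A O a ξ).u) i - (A *ᵥ st.u) i := by
      simp [mulVec, dotProduct, mul_sub]
    have h4 : ∑ j, |A i j| * phi ξ st.u j = (absM A *ᵥ phi ξ st.u) i := rfl
    rw [h1, h2, h3, h4, log_next_v]
    field_simp
    ring

theorem Valid.abs_log_next [NeZero m] (hb : Bounds A U ρ ξ B) (hO : BestResponds A U ψ ξ δ O)
    (ha : a = 120 * ρ * (1 + B) ^ 2) (h : st.Valid A U a ξ) (i : Fin m) :
    |Real.log ((st.next A O a ξ).v i) - Real.log (st.v i)| ≤ 1 / 2 := by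
  have hρ := hb.rho_pos
  have hB := hb.nonneg_B
  have hapos : 0 < a := by rw [ha]; positivity
  have h' := h.next hO hapos.ne'
  obtain ⟨c, hc⟩ := h.dual
  have key := abs_log_sub_log_le (κ := 1 / 4)
    (x := fun i => (∑ j, (A i j * st.u j + (A i j * (st.u j - st.uprev j)
      - |A i j| * (phi ξ st.u j - phi ξ st.uprev j)))) / a)
    (c := c / a - Real.log (∑ k, Real.exp
      ((st.S k + ((A *ᵥ st.u) k - (absM A *ᵥ phi ξ st.u) k)) / a)))
    h.v_mem h'.v_mem h.v_pos h'.v_pos ?_ ?_ i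
  · linarith
  · intro i
    rw [abs_div, abs_of_pos hapos, div_le_iff₀ hapos]
    have h1 : |∑ j, (A i j * st.u j + (A i j * (st.u j - st.uprev j)
        - |A i j| * (phi ξ st.u j - phi ξ st.uprev j)))|
        ≤ ∑ j, |A i j| * st.u j + (2 + B) * ∑ j, |A i j| * |st.u j - st.uprev j| := by
      rw [Finset.mul_sum, ← Finset.sum_add_distrib]
      refine (Finset.abs_sum_le_sum_abs _ _).trans (Finset.sum_le_sum fun j _ => ?_)
      refine (abs_add_le _ _).trans (add_le_add ?_ ((abs_sub _ _).trans ?_))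
      · rw [abs_mul, abs_of_nonneg (hb.nonneg _ h.u_mem j)]
      · rw [abs_mul, abs_mul, abs_abs]
        have := mul_le_mul_of_nonneg_left (hb.abs_phi_sub h.u_mem h.uprev_mem j)
          (abs_nonneg (A i j))
        linarith
    have h2 := hb.row _ h.u_mem i
    have h3 := mul_le_mul_of_nonneg_left (hb.row_abs_sub h.u_mem h.uprev_mem i)
      (by linarith : 0 ≤ 2 + B)
    rw [ha]
    nlinarith [mul_nonneg hρ.le hB, mul_nonneg (mul_nonneg hρ.le hB) hB]
  · intro i
    have h6 : ∑ j, (A i j * st.u j + (A i j * (st.u j - st.uprev j)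
        - |A i j| * (phi ξ st.u j - phi ξ st.uprev j)))
        = (A *ᵥ st.u) i + (∑ j, A i j * (st.u j - st.uprev j)
          - ((absM A *ᵥ phi ξ st.u) i - ∑ j, |A i j| * phi ξ st.uprev j)) := by
      simp [mulVec, dotProduct, absM, Finset.sum_add_distrib, mul_sub]
    simp only [log_next_v, h6, hc i]
    field_simp
    ring

theorem sum_sq_div_le {b v v' : Fin m → ℝ} (hv : ∀ i, 0 < v i) (hv' : ∀ i, 0 < v' i)
    (h : ∀ i, v' i ≤ 2 * v i) :
    ∑ i, b i ^ 2 / v i ≤ 3 * ∑ i, b i ^ 2 / (v' i + v i) := by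
  rw [Finset.mul_sum]
  refine Finset.sum_le_sum fun i _ => ?_
  have h1 := hv i
  have h2 := hv' i
  rw [div_le_iff₀ h1, mul_assoc, div_mul_eq_mul_div, mul_div_assoc', le_div_iff₀ (by positivity)]
  nlinarith [h i, sq_nonneg (b i)]

/-- The divergence between consecutive states dominates the change of the movement potential. -/
theorem Valid.div_next_ge [NeZero m] (hb : Bounds A U ρ ξ B) (hO : BestResponds A U ψ ξ δ O)
    (ha : a = 120 * ρ * (1 + B) ^ 2) (h : st.Valid A U a ξ) :
    1 / 4 * (st.next A O a ξ).move A ξ - 1 / 4 * st.move A ξ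
      ≤ st.div A a ξ (st.next A O a ξ).u (st.next A O a ξ).v := by
  have hρ := hb.rho_pos
  have hB := hb.nonneg_B
  have hapos : 0 < a := by rw [ha]; positivity
  have h' := h.next hO hapos.ne'
  have hclose := h.abs_log_next hb hO ha
  rw [h.div_eq _ h'.v_mem]
  have hprev : (st.next A O a ξ).uprev = st.u := rfl
  generalize st.next A O a ξ = st' at *
  have hr : ∀ i, st'.v i ≤ 2 * st.v i := fun i =>
    le_two_mul_of_log_sub_le (h'.v_pos i) (h.v_pos i) (hclose i)
  have hr' : ∀ i, st.v i ≤ 2 * st'.v i := fun i =>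
    le_two_mul_of_log_sub_le (h.v_pos i) (h'.v_pos i) (by rw [abs_sub_comm]; exact hclose i)
  set Q := ∑ i, (st'.v i - st.v i) ^ 2 / (st'.v i + st.v i) with hQ
  have e1 : 1 / 2 * st'.move A ξ ≤
      ∑ i, ∑ j, (st'.v i + ξ) * |A i j| * ((st'.u j + ξ) * Real.log (st'.u j + ξ)
        - (st'.u j + ξ) * Real.log (st.u j + ξ) - (st'.u j + ξ) + (st.u j + ξ)) := by
    rw [State.move, hprev, Finset.mul_sum]
    refine Finset.sum_le_sum fun i _ => ?_
    rw [Finset.mul_sum, Finset.mul_sum]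
    refine Finset.sum_le_sum fun j _ => ?_
    have g1 := entropy_ge (hb.add_xi_pos h'.u_mem j).le (hb.add_xi_pos h.u_mem j)
    have g2 := entropy_nonneg (hb.add_xi_pos h'.u_mem j).le (hb.add_xi_pos h.u_mem j)
    rw [add_sub_add_right_eq_sub] at g1
    have g3 := mul_le_mul_of_nonneg_left g1 (mul_nonneg (h'.v_pos i).le (abs_nonneg (A i j)))
    have g4 := mul_nonneg (mul_nonneg hb.xi_pos.le (abs_nonneg (A i j))) g2
    linarith
  have e2 := (abs_le.1 (hb.abs_curvature_le h.u_mem st'.u st'.v st.v)).1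
  have e3 := (abs_le.1 (hb.abs_lag_le h.u_mem h.uprev_mem st'.v st.v)).2
  have e4 : 1 / 2 * Q ≤
      ∑ i, (st'.v i * Real.log (st'.v i) - st'.v i * Real.log (st.v i) - st'.v i + st.v i) := by
    rw [hQ, Finset.mul_sum]
    exact Finset.sum_le_sum fun i _ => entropy_ge (h'.v_pos i).le (h.v_pos i)
  have e5 := cross_le_young A (st'.v - st.v) st'.v (st'.u - st.u)
    (fun j => (st'.u j + ξ) + (st.u j + ξ)) (K := 1 + B) h'.v_pos
    (fun j => add_pos (hb.add_xi_pos h'.u_mem j) (hb.add_xi_pos h.u_mem j))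
    (hb.row_add h'.u_mem h.u_mem)
  have e6 := cross_le_young A (st'.v - st.v) st.v (st.u - st.uprev)
    (fun j => (st.u j + ξ) + (st.uprev j + ξ)) (K := 2 * (1 + B)) h.v_pos
    (fun j => add_pos (hb.add_xi_pos h.u_mem j) (hb.add_xi_pos h.uprev_mem j))
    (hb.row_add h.u_mem h.uprev_mem)
  have e7 : ∑ i, (st'.v - st.v) i ^ 2 / st.v i ≤ 3 * Q :=
    sum_sq_div_le h.v_pos h'.v_pos hr
  have e8 : ∑ i, (st'.v - st.v) i ^ 2 / st'.v i ≤ 3 * Q := by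
    have := sum_sq_div_le (b := st'.v - st.v) h'.v_pos h.v_pos hr'
    simpa only [hQ, add_comm (st.v _), Pi.sub_apply] using this
  have m1 : st'.move A ξ = ∑ i, st'.v i * ∑ j, |A i j| *
      ((st'.u - st.u) j ^ 2 / ((st'.u j + ξ) + (st.u j + ξ))) := by
    rw [State.move, hprev]; rfl
  have m2 : st.move A ξ = ∑ i, st.v i * ∑ j, |A i j| *
      ((st.u - st.uprev) j ^ 2 / ((st.u j + ξ) + (st.uprev j + ξ))) := rfl
  rw [← m1] at e5
  rw [← m2] at e6
  have e9 := mul_le_mul_of_nonneg_left e8 (by positivity : 0 ≤ (1 + B) ^ 2 * (4 * ρ))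
  have e10 := mul_le_mul_of_nonneg_left e7 (by positivity : 0 ≤ (2 * (1 + B)) ^ 2 * (4 * ρ))
  have e11 := mul_le_mul_of_nonneg_left e4 hapos.le
  have e12 : a * (1 / 2 * Q) = (1 + B) ^ 2 * (4 * ρ) * (3 * Q)
      + (2 * (1 + B)) ^ 2 * (4 * ρ) * (3 * Q) := by rw [ha]; ring
  linarith

/-- The progress of one step against an arbitrary pair of points. -/
theorem Valid.gap_next_le [NeZero m] (hb : Bounds A U ρ ξ B) (hO : BestResponds A U ψ ξ δ O)
    (ha : a = 120 * ρ * (1 + B) ^ 2) (h : st.Valid A U a ξ) {u : Fin n → ℝ} (hu : u ∈ U)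
    (v : Fin m → ℝ) :
    v ⬝ᵥ (A *ᵥ (st.next A O a ξ).u) + ψ (st.next A O a ξ).u
        - (st.next A O a ξ).v ⬝ᵥ (A *ᵥ u) - ψ u
      ≤ (st.div A a ξ u v + 1 / 4 * st.move A ξ)
        - ((st.next A O a ξ).div A a ξ u v + 1 / 4 * (st.next A O a ξ).move A ξ) + δ := by
  have hdiv := h.div_next_ge hb hO ha
  have hbr := (hO (st.nextV A a ξ) (softmax_mem _) (st.nextH A a ξ)).2 u hu
  have hS : (st.next A O a ξ).S = st.S + A *ᵥ (st.next A O a ξ).u := rfl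
  have hbr' : (Aᵀ *ᵥ (st.next A O a ξ).v - entropicGrad A ξ st.u st.v
      + entropicGrad A ξ (st.next A O a ξ).u (st.next A O a ξ).v) ⬝ᵥ ((st.next A O a ξ).u - u)
      ≤ ψ u - ψ (st.next A O a ξ).u + δ := hbr
  generalize st.next A O a ξ = st' at *
  have hT : ∀ x : Fin n → ℝ, (Aᵀ *ᵥ st'.v) ⬝ᵥ x = st'.v ⬝ᵥ (A *ᵥ x) := fun x => by
    rw [mulVec_transpose, dotProduct_mulVec]
  simp only [State.div, hS, add_dotProduct, sub_dotProduct, dotProduct_sub, hT] at hbr' hdiv ⊢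
  rw [dotProduct_comm (A *ᵥ st'.u) v, dotProduct_comm (A *ᵥ st'.u) st'.v]
  linarith

theorem Valid.neg_div_le (hb : Bounds A U ρ ξ B) (ha : 0 ≤ a) (h : st.Valid A U a ξ)
    {u : Fin n → ℝ} (hu : u ∈ U) {v : Fin m → ℝ} (hv : v ∈ stdSimplex ℝ (Fin m)) :
    -st.div A a ξ u v ≤ 30 * ρ * B := by
  have hρ := hb.rho_pos
  have hB := hb.nonneg_B
  rw [h.div_eq _ hv]
  have e1 : 0 ≤ ∑ i, ∑ j, (v i + ξ) * |A i j| * ((u j + ξ) * Real.log (u j + ξ)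
        - (u j + ξ) * Real.log (st.u j + ξ) - (u j + ξ) + (st.u j + ξ)) :=
    Finset.sum_nonneg fun i _ => Finset.sum_nonneg fun j _ =>
      mul_nonneg (mul_nonneg (add_nonneg (hv.1 i) hb.xi_pos.le) (abs_nonneg _))
        (entropy_nonneg (hb.add_xi_pos hu j).le (hb.add_xi_pos h.u_mem j))
  have e2 := (abs_le.1 (hb.abs_curvature_le h.u_mem u v st.v)).1
  have e3 := (abs_le.1 (hb.abs_lag_le h.u_mem h.uprev_mem v st.v)).2
  have e4 : 0 ≤ a * ∑ i, (v i * Real.log (v i) - v i * Real.log (st.v i) - v i + st.v i) :=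
    mul_nonneg ha (Finset.sum_nonneg fun i _ => entropy_nonneg (hv.1 i) (h.v_pos i))
  have e5 := hb.cross_le hu h.u_mem (v - st.v)
  have e6 := hb.cross_le h.u_mem h.uprev_mem (v - st.v)
  have e7 : (1 + B) * ∑ i, |(v - st.v) i| ≤ 5 * B := hb.one_add_mul_sum_abs_sub_le hv h.v_mem
  have e8 := mul_le_mul_of_nonneg_left e5 (by linarith : 0 ≤ 1 + B)
  have e9 := mul_le_mul_of_nonneg_left e6 (by linarith : 0 ≤ 2 * (1 + B))
  have e10 := mul_le_mul_of_nonneg_left e7 hρ.le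
  linarith

theorem start_div_le [NeZero m] (hb : Bounds A U ρ ξ B) (hO : BestResponds A U ψ ξ δ O)
    (ha : a = 120 * ρ * (1 + B) ^ 2) {u : Fin n → ℝ} (hu : u ∈ U) {v : Fin m → ℝ}
    (hv : v ∈ stdSimplex ℝ (Fin m)) :
    (start A O ξ).div A a ξ u v ≤ 18 * ρ * B + 300 * ρ * (B * (1 + B) * Real.log m) := by
  have hρ := hb.rho_pos
  have hB := hb.nonneg_B
  have hapos : 0 < a := by rw [ha]; positivity
  have h : (start A O ξ).Valid A U a ξ := valid_start hO
  rw [h.div_eq _ hv]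
  have hprev : (start A O ξ).uprev = (start A O ξ).u := rfl
  have hunif : ∀ i, (start A O ξ).v i = 1 / (m : ℝ) := fun _ => rfl
  generalize start A O ξ = st at *
  have e1 : ∑ i, ∑ j, (v i + ξ) * |A i j| * ((u j + ξ) * Real.log (u j + ξ)
        - (u j + ξ) * Real.log (st.u j + ξ) - (u j + ξ) + (st.u j + ξ)) ≤ 8 * ρ * B := by
    have g1 : ∀ i, ∑ j, (v i + ξ) * |A i j| * ((u j + ξ) * Real.log (u j + ξ)
        - (u j + ξ) * Real.log (st.u j + ξ) - (u j + ξ) + (st.u j + ξ))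
        ≤ (v i + ξ) * (4 * ρ * B) := by
      intro i
      have hvi : 0 ≤ v i + ξ := add_nonneg (hv.1 i) hb.xi_pos.le
      have g2 : ∑ j, (v i + ξ) * |A i j| * ((u j + ξ) * Real.log (u j + ξ)
          - (u j + ξ) * Real.log (st.u j + ξ) - (u j + ξ) + (st.u j + ξ))
          ≤ ∑ j, (v i + ξ) * (2 * B) * (|A i j| * |u j - st.u j|) := by
        refine Finset.sum_le_sum fun j _ => ?_
        have g3 := entropy_le (hb.add_xi_pos hu j) (hb.add_xi_pos h.u_mem j) (hb.abs_log u hu j)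
          (hb.abs_log _ h.u_mem j)
        rw [add_sub_add_right_eq_sub] at g3
        have := mul_le_mul_of_nonneg_left g3 (mul_nonneg hvi (abs_nonneg (A i j)))
        linarith
      rw [← Finset.mul_sum] at g2
      have g4 := mul_le_mul_of_nonneg_left (hb.row_abs_sub hu h.u_mem i)
        (by positivity : 0 ≤ (v i + ξ) * (2 * B))
      linarith
    refine (Finset.sum_le_sum fun i _ => g1 i).trans ?_
    rw [← Finset.sum_mul, Finset.sum_add_distrib, hv.2]
    have g5 : ∑ _i : Fin m, ξ ≤ 1 := by simpa using hb.card_mul_xi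
    have := mul_le_mul_of_nonneg_right g5 (by positivity : 0 ≤ 4 * ρ * B)
    linarith
  have e2 := (abs_le.1 (hb.abs_curvature_le h.u_mem u v st.v)).2
  have e3 : ∑ i, ∑ j, (v i - st.v i) * (A i j * (st.u j - st.uprev j)
        - |A i j| * (phi ξ st.u j - phi ξ st.uprev j)) = 0 := by
    rw [hprev]; simp
  have e4 : ∑ i, (v i * Real.log (v i) - v i * Real.log (st.v i) - v i + st.v i)
      ≤ Real.log m := by
    have g1 : ∑ i, (v i * Real.log (v i) - v i * Real.log (st.v i) - v i + st.v i)
        ≤ ∑ i, (v i * Real.log m - v i + st.v i) := by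
      refine Finset.sum_le_sum fun i _ => ?_
      have hv1 : v i ≤ 1 := by
        rw [← hv.2]
        exact Finset.single_le_sum (fun k _ => hv.1 k) (Finset.mem_univ i)
      have g2 := Real.mul_log_nonpos (hv.1 i) hv1
      rw [hunif i, one_div, Real.log_inv]
      linarith
    refine g1.trans ?_
    rw [Finset.sum_add_distrib, Finset.sum_sub_distrib, ← Finset.sum_mul, hv.2, h.v_mem.2]
    linarith
  have e5 := hb.cross_le hu h.u_mem (v - st.v)
  have e7 : (1 + B) * ∑ i, |(v - st.v) i| ≤ 5 * B := hb.one_add_mul_sum_abs_sub_le hv h.v_mem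
  have e8 := mul_le_mul_of_nonneg_left e5 (by linarith : 0 ≤ 1 + B)
  have e10 := mul_le_mul_of_nonneg_left e7 hρ.le
  have e11 := mul_le_mul_of_nonneg_left e4 hapos.le
  have e12 := mul_le_mul_of_nonneg_left hb.sq_one_add_mul_log_le (by positivity : 0 ≤ 120 * ρ)
  have e13 : a * Real.log m = 120 * ρ * ((1 + B) ^ 2 * Real.log m) := by rw [ha]; ring
  linarith

/-- The states of the iteration. -/
def iter (A : Matrix (Fin m) (Fin n) ℝ)
    (O : (Fin m → ℝ) → (Fin n → ℝ) → ℝ → (Fin n → ℝ)) (a ξ : ℝ) (t : ℕ) : State m n :=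
  (next A O a ξ)^[t] (start A O ξ)

theorem iter_succ (t : ℕ) : iter A O a ξ (t + 1) = (iter A O a ξ t).next A O a ξ :=
  Function.iterate_succ_apply' _ _ _

theorem valid_iter [NeZero m] (hO : BestResponds A U ψ ξ δ O) (ha : a ≠ 0) (t : ℕ) :
    (iter A O a ξ t).Valid A U a ξ := by
  induction t with
  | zero => exact valid_start hO
  | succ t ih => rw [iter_succ]; exact ih.next hO ha

/-- The total regret of the iteration. -/
theorem sum_gap_le [NeZero m] (hb : Bounds A U ρ ξ B) (hO : BestResponds A U ψ ξ δ O)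
    (ha : a = 120 * ρ * (1 + B) ^ 2) {u : Fin n → ℝ} (hu : u ∈ U) {v : Fin m → ℝ}
    (hv : v ∈ stdSimplex ℝ (Fin m)) (N : ℕ) :
    ∑ t ∈ Finset.range N, (v ⬝ᵥ (A *ᵥ (iter A O a ξ (t + 1)).u) + ψ (iter A O a ξ (t + 1)).u
        - (iter A O a ξ (t + 1)).v ⬝ᵥ (A *ᵥ u) - ψ u)
      ≤ 300 * ρ * (B * (1 + B) * (1 + Real.log m)) + N * δ := by
  have hρ := hb.rho_pos
  have hB := hb.nonneg_B
  have hapos : 0 < a := by rw [ha]; positivity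
  have htel : ∑ t ∈ Finset.range N, (v ⬝ᵥ (A *ᵥ (iter A O a ξ (t + 1)).u)
        + ψ (iter A O a ξ (t + 1)).u - (iter A O a ξ (t + 1)).v ⬝ᵥ (A *ᵥ u) - ψ u)
      ≤ ((iter A O a ξ 0).div A a ξ u v + 1 / 4 * (iter A O a ξ 0).move A ξ)
        - ((iter A O a ξ N).div A a ξ u v + 1 / 4 * (iter A O a ξ N).move A ξ) + N * δ := by
    induction N with
    | zero => simp
    | succ N ih =>
      have := (valid_iter hO hapos.ne' N).gap_next_le hb hO ha hu v
      rw [Finset.sum_range_succ]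
      rw [← iter_succ] at this
      push_cast
      linarith
  have h0 : (iter A O a ξ 0).move A ξ = 0 := by simp [iter, move, start]
  have h1 : 0 ≤ (iter A O a ξ N).move A ξ := by
    have hval := valid_iter (a := a) hO hapos.ne' N
    refine Finset.sum_nonneg fun i _ => mul_nonneg (hval.v_pos i).le
      (Finset.sum_nonneg fun j _ => ?_)
    have := hb.add_xi_pos hval.u_mem j
    have := hb.add_xi_pos hval.uprev_mem j
    positivity
  have h2 := (valid_iter (a := a) hO hapos.ne' N).neg_div_le hb hapos.le hu hv
  have h3 : (iter A O a ξ 0).div A a ξ u v ≤ _ := start_div_le hb hO ha hu hv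
  have h4 : 0 ≤ ρ * B := by positivity
  have h5 : 0 ≤ ρ * B * B := by positivity
  linarith

/-- The averages of the iterates form an approximate equilibrium. -/
theorem average_gap_le [NeZero m] (hb : Bounds A U ρ ξ B) (hO : BestResponds A U ψ ξ δ O)
    (hψ : ConvexOn ℝ U ψ) (ha : a = 120 * ρ * (1 + B) ^ 2) {N : ℕ} (hN : 0 < N) :
    (∑ t ∈ Finset.range N, (N : ℝ)⁻¹ • (iter A O a ξ (t + 1)).u) ∈ U ∧
    (∑ t ∈ Finset.range N, (N : ℝ)⁻¹ • (iter A O a ξ (t + 1)).v) ∈ stdSimplex ℝ (Fin m) ∧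
    ∀ u ∈ U, ∀ v ∈ stdSimplex ℝ (Fin m),
      v ⬝ᵥ (A *ᵥ ∑ t ∈ Finset.range N, (N : ℝ)⁻¹ • (iter A O a ξ (t + 1)).u)
        + ψ (∑ t ∈ Finset.range N, (N : ℝ)⁻¹ • (iter A O a ξ (t + 1)).u)
      ≤ (∑ t ∈ Finset.range N, (N : ℝ)⁻¹ • (iter A O a ξ (t + 1)).v) ⬝ᵥ (A *ᵥ u) + ψ u
        + 300 * ρ * (B * (1 + B) * (1 + Real.log m)) / N + δ := by
  have hapos : 0 < a := by
    have := hb.rho_pos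
    have := hb.nonneg_B
    rw [ha]; positivity
  have hval := valid_iter (a := a) hO hapos.ne'
  have hNR : (0 : ℝ) < N := by exact_mod_cast hN
  have hw : ∀ t ∈ Finset.range N, 0 ≤ (N : ℝ)⁻¹ := fun _ _ => by positivity
  have hw1 : ∑ _t ∈ Finset.range N, (N : ℝ)⁻¹ = 1 := by
    simp [hNR.ne']
  refine ⟨hψ.1.sum_mem hw hw1 fun t _ => (hval (t + 1)).u_mem,
    (convex_stdSimplex ℝ (Fin m)).sum_mem hw hw1 fun t _ => (hval (t + 1)).v_mem, ?_⟩
  intro u hu v hv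
  have hjen := hψ.map_sum_le hw hw1 fun t _ => (hval (t + 1)).u_mem
  have hsum := mul_le_mul_of_nonneg_left (sum_gap_le hb hO ha hu hv N)
    (by positivity : 0 ≤ (N : ℝ)⁻¹)
  have h1 : v ⬝ᵥ (A *ᵥ ∑ t ∈ Finset.range N, (N : ℝ)⁻¹ • (iter A O a ξ (t + 1)).u)
      = (N : ℝ)⁻¹ * ∑ t ∈ Finset.range N, v ⬝ᵥ (A *ᵥ (iter A O a ξ (t + 1)).u) := by
    rw [← Finset.smul_sum, mulVec_smul, dotProduct_smul, mulVec_sum, dotProduct_sum, smul_eq_mul]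
  have h2 : (∑ t ∈ Finset.range N, (N : ℝ)⁻¹ • (iter A O a ξ (t + 1)).v) ⬝ᵥ (A *ᵥ u)
      = (N : ℝ)⁻¹ * ∑ t ∈ Finset.range N, (iter A O a ξ (t + 1)).v ⬝ᵥ (A *ᵥ u) := by
    rw [← Finset.smul_sum, smul_dotProduct, sum_dotProduct, smul_eq_mul]
  have h3 : (N : ℝ)⁻¹ * ∑ t ∈ Finset.range N, ψ (iter A O a ξ (t + 1)).u
      = ∑ t ∈ Finset.range N, (N : ℝ)⁻¹ • ψ (iter A O a ξ (t + 1)).u := by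
    simp [Finset.mul_sum]
  have h4 : (N : ℝ)⁻¹ * (N * ψ u) = ψ u := by field_simp
  have h5 : (N : ℝ)⁻¹ * (N * δ) = δ := by field_simp
  simp only [Finset.sum_sub_distrib, Finset.sum_add_distrib, Finset.sum_const, Finset.card_range,
    nsmul_eq_mul, mul_sub, mul_add] at hsum
  rw [h1, h2]
  have h6 : 300 * ρ * (B * (1 + B) * (1 + Real.log m)) / N
      = (N : ℝ)⁻¹ * (300 * ρ * (B * (1 + B) * (1 + Real.log m))) := by ring
  rw [h6]
  have h7 : (N : ℝ)⁻¹ * (300 * ρ * (B * (1 + B) * (1 + Real.log m)) + N * δ)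
      = (N : ℝ)⁻¹ * (300 * ρ * (B * (1 + B) * (1 + Real.log m))) + δ := by
    rw [mul_add, h5]
  linarith

theorem norm_nextH_le [NeZero m] (hb : Bounds A U ρ ξ B) (h : st.Valid A U a ξ) :
    ‖st.nextH A a ξ‖ ≤ (2 * B + 3) * opNormInf A := by
  have hB := hb.nonneg_B
  have hop : 0 ≤ opNormInf A := norm_nonneg _
  have hentry : ∀ i j, |A i j| ≤ opNormInf A := fun i j => by
    have h1 : |A i j| ≤ ∑ k, |A i k| :=
      Finset.single_le_sum (f := fun k => |A i k|) (fun k _ => abs_nonneg _) (Finset.mem_univ j)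
    exact h1.trans ((le_abs_self _).trans (norm_le_pi_norm (fun i : Fin m => ∑ j, |A i j|) i))
  have havg : ∀ w : Fin m → ℝ, (∀ i, 0 ≤ w i) → ∀ j, ∑ i, |A i j| * w i
      ≤ opNormInf A * ∑ i, w i := fun w hw j => by
    rw [Finset.mul_sum]
    exact Finset.sum_le_sum fun i _ => mul_le_mul_of_nonneg_right (hentry i j) (hw i)
  refine (pi_norm_le_iff_of_nonneg (by positivity)).2 fun j => ?_
  have h1 : |(Aᵀ *ᵥ st.nextV A a ξ) j| ≤ opNormInf A := by
    have hv : st.nextV A a ξ ∈ stdSimplex ℝ (Fin m) := softmax_mem _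
    have h2 := havg _ hv.1 j
    rw [hv.2, mul_one] at h2
    refine le_trans ?_ h2
    have h3 : (Aᵀ *ᵥ st.nextV A a ξ) j = ∑ i, A i j * st.nextV A a ξ i := rfl
    rw [h3]
    refine (Finset.abs_sum_le_sum_abs _ _).trans (Finset.sum_le_sum fun i _ => ?_)
    rw [abs_mul, abs_of_nonneg (hv.1 i)]
  have h2 : |entropicGrad A ξ st.u st.v j| ≤ 2 * opNormInf A * (1 + B) := by
    rw [entropicGrad, abs_mul]
    refine mul_le_mul ?_ (hb.abs_one_add_log h.u_mem j) (abs_nonneg _) (by positivity)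
    have hpos : ∀ i, 0 ≤ st.v i + ξ := fun i => add_nonneg (h.v_pos i).le hb.xi_pos.le
    have h3 := havg _ hpos j
    have h4 : ((absM A)ᵀ *ᵥ fun i => st.v i + ξ) j = ∑ i, |A i j| * (st.v i + ξ) := rfl
    rw [h4, abs_of_nonneg (Finset.sum_nonneg fun i _ => mul_nonneg (abs_nonneg _) (hpos i))]
    refine h3.trans ?_
    have h5 : ∑ _i : Fin m, ξ ≤ 1 := by simpa using hb.card_mul_xi
    rw [Finset.sum_add_distrib, h.v_mem.2]
    have := mul_le_mul_of_nonneg_left h5 hop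
    linarith
  rw [Real.norm_eq_abs, nextH, Pi.sub_apply]
  exact (abs_sub _ _).trans (by linarith)

end State

/-! ### The program

Scalar registers: `5` holds `1`, `6` holds `ξ`, `7` holds `B`, `8` holds the weight of the entropy,
`9` the number of iterations, `10` an iteration counter. Vector registers: `x 2`, `y 2` hold the
current point, `x 3` the gradient `∇_U r`, `y 3` the accumulated dual gradient, `y 4` the
correction of the latter, `x 0`, `y 0` the sums of the iterates. -/

/-- Computes the parameters. -/
def setupProg : Prog :=
  .seq (.sConst 5 1) <| .seq (.xFill 1 5) <| .seq (.mulAbs 1 1) <| .seq (.yMax 6 1) <|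
  .seq (.sBin .mul 11 1 0) <| .seq (.sBin .mul 11 11 6) <| .seq (.sBin .div 11 2 11) <|
  .seq (.sBin .min 6 5 11) <|
  .seq (.sBin .div 11 5 6) <| .seq (.sBin .add 12 3 6) <| .seq (.sBin .max 11 11 12) <|
  .seq (.sUn .log 7 11) <|
  .seq (.sBin .add 11 5 7) <| .seq (.sConst 8 120) <| .seq (.sBin .mul 8 8 2) <|
  .seq (.sBin .mul 8 8 11) <| .seq (.sBin .mul 8 8 11) <|
  .seq (.sUn .log 12 0) <| .seq (.sBin .add 12 5 12) <| .seq (.sBin .mul 12 11 12) <|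
  .seq (.sBin .mul 12 7 12) <| .seq (.sConst 9 300) <| .seq (.sBin .mul 9 9 12) <|
  .seq (.sBin .div 9 9 4) <| .sBin .add 9 9 5

/-- Computes `∇_U r`, `A u` and `|A| φ(u)` at the current point. -/
def refreshProg : Prog :=
  .seq (.xFill 5 6) <| .seq (.xBin .add 5 2 5) <| .seq (.xUn .log 6 5) <|
  .seq (.xBin .mul 5 5 6) <| .seq (.xFill 1 5) <| .seq (.xBin .add 6 1 6) <|
  .seq (.yFill 5 6) <| .seq (.yBin .add 5 2 5) <| .seq (.mulAbsT 3 5) <|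
  .seq (.xBin .mul 3 3 6) <| .seq (.mulA 6 2) <| .seq (.mulAbs 7 5) <| .yBin .sub 4 6 7

/-- Computes the initial state. -/
def startProg : Prog :=
  .seq (.sBin .div 11 5 0) <| .seq (.yFill 2 11) <| .seq (.call 2 2 4 5) <|
  .seq refreshProg <| .yBin .max 3 7 7

/-- Moves to the next point. -/
def moveProg : Prog :=
  .seq (.yBin .add 5 3 4) <| .seq (.yFill 6 8) <| .seq (.yBin .div 5 5 6) <|
  .seq (.yUn .exp 5 5) <| .seq (.ySum 11 5) <| .seq (.yFill 6 11) <| .seq (.yBin .div 2 5 6) <|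
  .seq (.mulAT 4 2) <| .seq (.xBin .sub 4 4 3) <| .call 2 2 4 5

/-- Accumulates the dual gradient and the iterates. -/
def accumulateProg : Prog :=
  .seq (.yBin .add 3 3 6) <| .seq (.xBin .add 0 0 2) <| .seq (.yBin .add 0 0 2) <|
  .sBin .add 10 10 5

/-- One iteration. -/
def bodyProg : Prog :=
  .seq moveProg <| .seq refreshProg accumulateProg

/-- Divides the sums of the iterates by their number. -/
def averageProg : Prog :=
  .seq (.xFill 5 10) <| .seq (.xBin .div 0 0 5) <| .seq (.yFill 5 10) <| .yBin .div 0 0 5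

/-- The whole program. -/
def mainProg : Prog :=
  .seq setupProg <| .seq startProg <| .seq (.loop 9 bodyProg) averageProg

variable {m n : ℕ} {A : Matrix (Fin m) (Fin n) ℝ} {U : Set (Fin n → ℝ)} {ψ : (Fin n → ℝ) → ℝ}
  {ρ R ξ B a ε δ : ℝ} {O : (Fin m → ℝ) → (Fin n → ℝ) → ℝ → (Fin n → ℝ)} {σ : Machine m n}

theorem opNormInf_eq_iSup [NeZero m] (A : Matrix (Fin m) (Fin n) ℝ) :
    (⨆ i, (absM A *ᵥ fun _ => (1 : ℝ)) i) = opNormInf A := by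
  have h : (absM A *ᵥ fun _ => (1 : ℝ)) = fun i : Fin m => ∑ j, |A i j| := by
    funext i
    simp [mulVec, dotProduct, absM]
  rw [h, opNormInf]
  have hbdd : BddAbove (Set.range fun i : Fin m => ∑ j, |A i j|) := Set.finite_range _ |>.bddAbove
  have h0 : ∀ i : Fin m, 0 ≤ ∑ j, |A i j| := fun i => Finset.sum_nonneg fun j _ => abs_nonneg _
  refine le_antisymm (ciSup_le fun i => ?_) ?_
  · exact (le_abs_self _).trans (norm_le_pi_norm (fun i : Fin m => ∑ j, |A i j|) i)
  · refine (pi_norm_le_iff_of_nonneg ((h0 0).trans (le_ciSup hbdd 0))).2 fun i => ?_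
    rw [Real.norm_eq_abs, abs_of_nonneg (h0 i)]
    exact le_ciSup hbdd i

theorem run_setupProg [NeZero m] (A : Matrix (Fin m) (Fin n) ℝ)
    (O : (Fin m → ℝ) → (Fin n → ℝ) → ℝ → (Fin n → ℝ)) (ρ R ε : ℝ)
    (hξ : ξ = xiParam A ρ) (hB : B = logParam A ρ R) (ha : a = 120 * ρ * (1 + B) ^ 2) :
    let τ := setupProg.run A O (initial m n ρ R ε)
    τ.s 0 = m ∧ τ.s 5 = 1 ∧ τ.s 6 = ξ ∧ τ.s 8 = a ∧
    τ.s 9 = 300 * (B * ((1 + B) * (1 + Real.log m))) / ε + 1 ∧ τ.s 10 = 0 ∧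
    τ.x 0 = 0 ∧ τ.y 0 = 0 ∧ τ.x 4 = 0 ∧
    τ.arith = 22 + n + 2 * m ∧ τ.products = 1 ∧ τ.queries = [] := by
  have hsup := opNormInf_eq_iSup A
  have ha' : a = 120 * ρ * (1 + B) * (1 + B) := by rw [ha]; ring
  subst hB hξ ha'
  simp only [setupProg, Prog.run, initial, Machine.setS, Machine.setX, Machine.setY,
    Machine.countProduct, BinOp.app, UnOp.app, Function.update_apply]
  norm_num [hsup, logParam, xiParam]
  ring

theorem run_refreshProg (A : Matrix (Fin m) (Fin n) ℝ)
    (O : (Fin m → ℝ) → (Fin n → ℝ) → ℝ → (Fin n → ℝ)) (h5 : σ.s 5 = 1) :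
    let τ := refreshProg.run A O σ
    τ.s = σ.s ∧ τ.x 0 = σ.x 0 ∧ τ.x 2 = σ.x 2 ∧
    τ.x 3 = entropicGrad A (σ.s 6) (σ.x 2) (σ.y 2) ∧
    τ.y 0 = σ.y 0 ∧ τ.y 2 = σ.y 2 ∧ τ.y 3 = σ.y 3 ∧
    τ.y 4 = A *ᵥ σ.x 2 - absM A *ᵥ phi (σ.s 6) (σ.x 2) ∧ τ.y 6 = A *ᵥ σ.x 2 ∧
    τ.y 7 = absM A *ᵥ phi (σ.s 6) (σ.x 2) ∧
    τ.arith = σ.arith + 8 * n + 5 * m ∧ τ.products = σ.products + 3 ∧ τ.queries = σ.queries := by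
  simp only [refreshProg, Prog.run, Machine.setX, Machine.setY,
    Machine.countProduct, BinOp.app, UnOp.app, Function.update_apply]
  norm_num [h5]
  refine ⟨rfl, rfl, rfl, ?_⟩
  ring

theorem run_startProg (A : Matrix (Fin m) (Fin n) ℝ)
    (O : (Fin m → ℝ) → (Fin n → ℝ) → ℝ → (Fin n → ℝ)) (h0 : σ.s 0 = m) (h5 : σ.s 5 = 1)
    (h6 : σ.s 6 = ξ) (hx : σ.x 4 = 0) :
    let τ := startProg.run A O σ
    let st := State.start A O ξ
    (∀ k, k ≠ 11 → τ.s k = σ.s k) ∧ τ.x 0 = σ.x 0 ∧ τ.x 2 = st.u ∧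
    τ.x 3 = entropicGrad A ξ st.u st.v ∧
    τ.y 0 = σ.y 0 ∧ τ.y 2 = st.v ∧ τ.y 3 = st.S ∧
    τ.y 4 = A *ᵥ st.u - absM A *ᵥ phi ξ st.u ∧
    τ.arith = σ.arith + 9 * n + 8 * m + 1 ∧ τ.products = σ.products + 3 ∧
    τ.queries = ⟨st.v, 0, 1⟩ :: σ.queries := by
  intro τ st
  set σ' := Prog.run A O (.call 2 2 4 5) (Prog.run A O (.yFill 2 11)
    (Prog.run A O (.sBin .div 11 5 0) σ)) with hσ'
  have hs : σ'.s = Function.update σ.s 11 (1 / m) := by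
    simp [hσ', Prog.run, Machine.setS, Machine.setX, Machine.setY, Machine.record, BinOp.app, h0,
      h5]
  have hx2 : σ'.x 2 = st.u := by
    simp [hσ', Prog.run, Machine.setS, Machine.setX, Machine.setY, Machine.record, BinOp.app, h0,
      h5, hx, st, State.start]
  have hx0 : σ'.x 0 = σ.x 0 := by
    simp [hσ', Prog.run, Machine.setS, Machine.setX, Machine.setY, Machine.record]
  have hy0 : σ'.y 0 = σ.y 0 := by
    simp [hσ', Prog.run, Machine.setS, Machine.setX, Machine.setY, Machine.record]
  have hy2 : σ'.y 2 = st.v := by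
    simp [hσ', Prog.run, Machine.setS, Machine.setX, Machine.setY, Machine.record, BinOp.app, h0,
      h5, st, State.start]
  have har : σ'.arith = σ.arith + 1 + m + (m + n) := by
    simp [hσ', Prog.run, Machine.setS, Machine.setX, Machine.setY, Machine.record]
  have hp : σ'.products = σ.products := by
    simp [hσ', Prog.run, Machine.setS, Machine.setX, Machine.setY, Machine.record]
  have hq : σ'.queries = ⟨st.v, 0, 1⟩ :: σ.queries := by
    simp [hσ', Prog.run, Machine.setS, Machine.setX, Machine.setY, Machine.record, BinOp.app, h0,
      h5, hx, st, State.start]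
  have h5' : σ'.s 5 = 1 := by simp [hs, h5]
  have h6' : σ'.s 6 = ξ := by simp [hs, h6]
  obtain ⟨r1, r2, r3, r4, r5, r6, r7, r8, r9, r10, r11, r12, r13⟩ :=
    run_refreshProg A O (σ := σ') h5'
  have hτ : τ = Prog.run A O (.yBin .max 3 7 7) (refreshProg.run A O σ') := rfl
  generalize refreshProg.run A O σ' = σ'' at *
  simp only [hτ, Prog.run, Machine.setY, BinOp.app, max_self]
  rw [h6', hx2, hy2] at r4
  rw [h6', hx2] at r8 r10
  refine ⟨fun k hk => by rw [r1, hs, Function.update_of_ne hk], r2.trans hx0, r3.trans hx2, r4,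
    by simpa using r5.trans hy0, by simpa using r6.trans hy2, by simp only [Function.update_self]; exact r10,
    by simpa using r8, by rw [r11, har]; ring, by rw [r12, hp], r13.trans hq⟩

theorem run_moveProg (A : Matrix (Fin m) (Fin n) ℝ)
    (O : (Fin m → ℝ) → (Fin n → ℝ) → ℝ → (Fin n → ℝ)) {st : State m n} (h5 : σ.s 5 = 1)
    (h8 : σ.s 8 = a) (hx3 : σ.x 3 = entropicGrad A ξ st.u st.v) (hy3 : σ.y 3 = st.S)
    (hy4 : σ.y 4 = A *ᵥ st.u - absM A *ᵥ phi ξ st.u) :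
    let τ := moveProg.run A O σ
    (∀ k, k ≠ 11 → τ.s k = σ.s k) ∧ τ.x 0 = σ.x 0 ∧ τ.x 2 = (st.next A O a ξ).u ∧
    τ.y 0 = σ.y 0 ∧ τ.y 2 = (st.next A O a ξ).v ∧ τ.y 3 = st.S ∧
    τ.arith = σ.arith + 3 * n + 8 * m ∧ τ.products = σ.products + 1 ∧
    τ.queries = ⟨st.nextV A a ξ, st.nextH A a ξ, 1⟩ :: σ.queries := by
  have hV : st.nextV A a ξ = fun i => Real.exp ((st.S i + (A *ᵥ st.u - absM A *ᵥ phi ξ st.u) i) / a)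
      / ∑ k, Real.exp ((st.S k + (A *ᵥ st.u - absM A *ᵥ phi ξ st.u) k) / a) := rfl
  have hH : st.nextH A a ξ = fun j => (Aᵀ *ᵥ st.nextV A a ξ) j - entropicGrad A ξ st.u st.v j := rfl
  have hu : (st.next A O a ξ).u = O (st.nextV A a ξ) (st.nextH A a ξ) 1 := rfl
  have hv : (st.next A O a ξ).v = st.nextV A a ξ := rfl
  rw [hu, hv, hH, hV]
  simp only [moveProg, Prog.run, Machine.setS, Machine.setX, Machine.setY,
    Machine.countProduct, Machine.record, BinOp.app, UnOp.app]
  refine ⟨fun k hk => by simp [hk], ?_, ?_, ?_, ?_, ?_, by ring, trivial, ?_⟩ <;>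
    simp [h5, h8, hx3, hy3, hy4]

/-- The machine after `t` iterations. -/
structure Simulates (A : Matrix (Fin m) (Fin n) ℝ)
    (O : (Fin m → ℝ) → (Fin n → ℝ) → ℝ → (Fin n → ℝ)) (a ξ : ℝ) (good : Query m n → Prop)
    (t : ℕ) (σ : Machine m n) : Prop where
  s5 : σ.s 5 = 1
  s6 : σ.s 6 = ξ
  s8 : σ.s 8 = a
  s10 : σ.s 10 = t
  x0 : σ.x 0 = ∑ k ∈ Finset.range t, (State.iter A O a ξ (k + 1)).u
  y0 : σ.y 0 = ∑ k ∈ Finset.range t, (State.iter A O a ξ (k + 1)).v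
  x2 : σ.x 2 = (State.iter A O a ξ t).u
  x3 : σ.x 3 = entropicGrad A ξ (State.iter A O a ξ t).u (State.iter A O a ξ t).v
  y2 : σ.y 2 = (State.iter A O a ξ t).v
  y3 : σ.y 3 = (State.iter A O a ξ t).S
  y4 : σ.y 4 = A *ᵥ (State.iter A O a ξ t).u - absM A *ᵥ phi ξ (State.iter A O a ξ t).u
  arith : σ.arith = 24 + 10 * n + 10 * m + t * (2 + 12 * n + 15 * m)
  products : σ.products = 4 + 4 * t
  calls : σ.queries.length = 1 + t
  queries : ∀ q ∈ σ.queries, good q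

theorem Simulates.body {good : Query m n → Prop} {t : ℕ} (h : Simulates A O a ξ good t σ)
    (hgood : good ⟨(State.iter A O a ξ t).nextV A a ξ, (State.iter A O a ξ t).nextH A a ξ, 1⟩) :
    Simulates A O a ξ good (t + 1) ((bodyProg.run A O σ).tick 1) := by
  obtain ⟨q1, q2, q3, q4, q5, q6, q7, q8, q9⟩ := run_moveProg A O h.s5 h.s8 h.x3 h.y3 h.y4
  have hrun : (bodyProg.run A O σ).tick 1 =
      (accumulateProg.run A O (refreshProg.run A O (moveProg.run A O σ))).tick 1 := rfl
  rw [hrun]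
  generalize moveProg.run A O σ = σ' at *
  have h5' : σ'.s 5 = 1 := (q1 5 (by norm_num)).trans h.s5
  have h6' : σ'.s 6 = ξ := (q1 6 (by norm_num)).trans h.s6
  have h8' : σ'.s 8 = a := (q1 8 (by norm_num)).trans h.s8
  have h10' : σ'.s 10 = t := (q1 10 (by norm_num)).trans h.s10
  obtain ⟨r1, r2, r3, r4, r5, r6, r7, r8, r9, r10, r11, r12, r13⟩ :=
    run_refreshProg A O (σ := σ') h5'
  generalize refreshProg.run A O σ' = σ'' at *
  rw [← State.iter_succ] at q3 q5
  rw [h6', q3, q5] at r4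
  rw [h6', q3] at r8
  rw [q3] at r9
  have hS : (State.iter A O a ξ (t + 1)).S
      = (State.iter A O a ξ t).S + A *ᵥ (State.iter A O a ξ (t + 1)).u := by
    rw [State.iter_succ]; rfl
  have x2' := r3.trans q3
  have y2' := r6.trans q5
  have x0' := (r2.trans q2).trans h.x0
  have y0' := (r5.trans q4).trans h.y0
  have y3' := r7.trans q6
  constructor <;> simp only [accumulateProg, Prog.run, Machine.setS, Machine.setX, Machine.setY,
    Machine.tick, BinOp.app]
  · simp [r1, h5']
  · simp [r1, h6']
  · simp [r1, h8']
  · simp [r1, h5', h10']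
  · simp only [Function.update_self, x0', x2', Finset.sum_range_succ]; rfl
  · simp only [Function.update_self, Function.update_of_ne, ne_eq, OfNat.zero_ne_ofNat,
      not_false_eq_true, Nat.reduceEqDiff, y0', y2', Finset.sum_range_succ]
    rfl
  · simpa using x2'
  · simpa using r4
  · simpa using y2'
  · rw [hS]
    simp [y3', r9]
    rfl
  · simpa using r8
  · rw [r11, q7, h.arith]; ring
  · rw [r12, q8, h.products]; ring
  · rw [r13, q9, List.length_cons, h.calls]; ring
  · rw [r13, q9]
    intro q hq
    rcases List.mem_cons.1 hq with rfl | hq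
    · exact hgood
    · exact h.queries q hq

theorem Simulates.loop {good : Query m n → Prop} {σ : Machine m n}
    (h : Simulates A O a ξ good 0 (σ.tick 1))
    (hgood : ∀ t, good
      ⟨(State.iter A O a ξ t).nextV A a ξ, (State.iter A O a ξ t).nextH A a ξ, 1⟩) :
    Simulates A O a ξ good ⌈σ.s 9⌉₊ (Prog.run A O (.loop 9 bodyProg) σ) := by
  have key : ∀ N : ℕ, Simulates A O a ξ good N
      ((fun τ => (bodyProg.run A O τ).tick 1)^[N] (σ.tick 1)) := by
    intro N
    induction N with
    | zero => exact h
    | succ N ih =>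
      rw [Function.iterate_succ_apply']
      exact ih.body (hgood N)
  exact key _

/-- The outcome of the program in terms of the iteration. -/
theorem run_mainProg [NeZero m] {good : Query m n → Prop} (ρ R ε : ℝ)
    (hξ : ξ = xiParam A ρ) (hB : B = logParam A ρ R) (ha : a = 120 * ρ * (1 + B) ^ 2)
    (hstart : good ⟨fun _ => 1 / (m : ℝ), 0, 1⟩)
    (hgood : ∀ t, good
      ⟨(State.iter A O a ξ t).nextV A a ξ, (State.iter A O a ξ t).nextH A a ξ, 1⟩) :
    let σ := mainProg.run A O (initial m n ρ R ε)
    let N := ⌈300 * (B * ((1 + B) * (1 + Real.log m))) / ε + 1⌉₊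
    σ.x 0 = ∑ k ∈ Finset.range N, (N : ℝ)⁻¹ • (State.iter A O a ξ (k + 1)).u ∧
    σ.y 0 = ∑ k ∈ Finset.range N, (N : ℝ)⁻¹ • (State.iter A O a ξ (k + 1)).v ∧
    σ.arith = 24 + 12 * n + 12 * m + N * (2 + 12 * n + 15 * m) ∧
    σ.products = 4 + 4 * N ∧ σ.queries.length = 1 + N ∧ ∀ q ∈ σ.queries, good q := by
  intro σ N
  obtain ⟨p1, p2, p3, p4, p5, p6, p7, p8, p9, p10, p11, p12⟩ :=
    run_setupProg A O ρ R ε hξ hB ha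
  have hσ : σ = averageProg.run A O (Prog.run A O (.loop 9 bodyProg)
    (startProg.run A O (setupProg.run A O (initial m n ρ R ε)))) := rfl
  generalize setupProg.run A O (initial m n ρ R ε) = σ₁ at *
  obtain ⟨q1, q2, q3, q4, q5, q6, q7, q8, q9, q10, q11⟩ := run_startProg A O p1 p2 p3 p9
  generalize startProg.run A O σ₁ = σ₂ at *
  have h0 : Simulates A O a ξ good 0 (σ₂.tick 1) := by
    constructor <;> simp only [Machine.tick]
    · rw [q1 5 (by norm_num), p2]
    · rw [q1 6 (by norm_num), p3]
    · rw [q1 8 (by norm_num), p4]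
    · rw [q1 10 (by norm_num), p6]; simp
    · rw [q2, p7]; simp
    · rw [q5, p8]; simp
    · exact q3
    · exact q4
    · exact q6
    · exact q7
    · exact q8
    · rw [q9, p10]; ring
    · rw [q10, p11]
    · rw [q11, p12]; rfl
    · rw [q11, p12]
      intro q hq
      rw [List.mem_singleton.1 hq]
      exact hstart
  have hN := h0.loop hgood
  rw [q1 9 (by norm_num), p5] at hN
  change Simulates A O a ξ good N _ at hN
  generalize Prog.run A O (.loop 9 bodyProg) σ₂ = σ₃ at *
  have x0 := hN.x0
  have y0 := hN.y0
  have s10 := hN.s10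
  rw [hσ]
  simp only [averageProg, Prog.run, Machine.setX, Machine.setY, BinOp.app]
  refine ⟨?_, ?_, ?_, hN.products, hN.calls, hN.queries⟩
  · rw [← Finset.smul_sum, ← x0]
    funext j
    simp [s10]
    ring
  · rw [← Finset.smul_sum, ← y0]
    funext i
    simp [s10]
    ring
  · rw [hN.arith]; ring

/-! ### The parameters -/

theorem pos_of_le_mul_opNormInf (hρ : 0 < ρ) (h : ρ ≤ n * opNormInf A) :
    0 < m ∧ 0 < n ∧ 0 < opNormInf A := by
  have hpos : 0 < n * opNormInf A := hρ.trans_le h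
  have hn : n ≠ 0 := by rintro rfl; simp at hpos
  have hop : 0 < opNormInf A := pos_of_mul_pos_right hpos (by positivity)
  refine ⟨Nat.pos_of_ne_zero ?_, Nat.pos_of_ne_zero hn, hop⟩
  rintro rfl
  simp [opNormInf, Subsingleton.elim (fun i : Fin 0 => ∑ j, |A i j|) 0] at hop

theorem sum_abs_le_opNormInf (A : Matrix (Fin m) (Fin n) ℝ) (i : Fin m) :
    ∑ j, |A i j| ≤ opNormInf A :=
  (le_abs_self _).trans (norm_le_pi_norm (fun i : Fin m => ∑ j, |A i j|) i)

theorem xiParam_eq (hρ : 0 < ρ) (h : ρ ≤ n * opNormInf A) :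
    xiParam A ρ = ρ / (n * m * opNormInf A) := by
  obtain ⟨hm, hn, hop⟩ := pos_of_le_mul_opNormInf hρ h
  refine min_eq_right ?_
  have hm1 : (1 : ℝ) ≤ m := by exact_mod_cast hm
  rw [div_le_one (by positivity)]
  calc ρ ≤ n * opNormInf A := h
    _ ≤ m * (n * opNormInf A) := le_mul_of_one_le_left (by positivity) hm1
    _ = _ := by ring

theorem xiParam_pos (hρ : 0 < ρ) (h : ρ ≤ n * opNormInf A) : 0 < xiParam A ρ := by
  obtain ⟨hm, hn, hop⟩ := pos_of_le_mul_opNormInf hρ h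
  rw [xiParam_eq hρ h]
  positivity

theorem card_mul_xiParam_le (hρ : 0 < ρ) (h : ρ ≤ n * opNormInf A) : m * xiParam A ρ ≤ 1 := by
  obtain ⟨hm, hn, hop⟩ := pos_of_le_mul_opNormInf hρ h
  rw [xiParam_eq hρ h, mul_div_assoc', div_le_one (by positivity)]
  calc m * ρ ≤ m * (n * opNormInf A) := by gcongr
    _ = _ := by ring

theorem bounds_of_params (hU : ∀ u ∈ U, 0 ≤ u) (hρ : 0 < ρ)
    (hrow : ∀ u ∈ U, ‖absM A *ᵥ u‖ ≤ ρ) (h : ρ ≤ n * opNormInf A) (hR : ∀ u ∈ U, ‖u‖ ≤ R) :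
    Bounds A U ρ (xiParam A ρ) (logParam A ρ R) := by
  obtain ⟨hm, hn, hop⟩ := pos_of_le_mul_opNormInf hρ h
  have hξ := xiParam_pos hρ h
  have hmξ := card_mul_xiParam_le hρ h
  have hm1 : (1 : ℝ) ≤ m := by exact_mod_cast hm
  have hn1 : (1 : ℝ) ≤ n := by exact_mod_cast hn
  have hinv : (m : ℝ) ≤ 1 / xiParam A ρ := by rwa [le_div_iff₀ hξ]
  have hmax : (m : ℝ) ≤ max (1 / xiParam A ρ) (R + xiParam A ρ) := hinv.trans (le_max_left _ _)
  have hlogm : Real.log m ≤ logParam A ρ R := Real.log_le_log (by linarith) hmax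
  refine ⟨hρ, hξ, (Real.log_nonneg hm1).trans hlogm, hmξ, fun i => ?_, fun u hu j => hU u hu j,
    fun u hu i => ?_, fun u hu j => ?_, hlogm⟩
  · rw [← Finset.sum_mul]
    calc (∑ j, |A i j|) * xiParam A ρ ≤ opNormInf A * xiParam A ρ := by
          have := sum_abs_le_opNormInf A i
          gcongr
      _ = ρ / (n * m) := by rw [xiParam_eq hρ h]; field_simp
      _ ≤ ρ := div_le_self hρ.le (by nlinarith)
  · exact (le_abs_self _).trans ((norm_le_pi_norm (absM A *ᵥ u) i).trans (hrow u hu))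
  · have huj : 0 ≤ u j := hU u hu j
    have hle : u j ≤ R := (le_abs_self _).trans ((norm_le_pi_norm u j).trans (hR u hu))
    rw [abs_le]
    constructor
    · have h1 : Real.log (1 / xiParam A ρ) ≤ logParam A ρ R :=
        Real.log_le_log (by positivity) (le_max_left _ _)
      rw [one_div, Real.log_inv] at h1
      have h2 : Real.log (xiParam A ρ) ≤ Real.log (u j + xiParam A ρ) :=
        Real.log_le_log hξ (by linarith)
      linarith
    · exact Real.log_le_log (by linarith) (le_max_of_le_right (by linarith))

theorem IsABRO.bestResponds {α : ℝ} (hO : IsABRO U ψ (doublyEntropic A α ξ) δ O)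
    (hU : ∀ u ∈ U, ∀ j, u j + ξ ≠ 0) : BestResponds A U ψ ξ δ O := by
  intro v hv h
  obtain ⟨h1, h2, -⟩ := hO v hv h 1 ⟨by norm_num, le_rfl⟩
  refine ⟨h1, fun u hu => ?_⟩
  have := h2 u hu
  rwa [gradU_doublyEntropic A α ξ _ v (hU _ h1), one_mul] at this

theorem IsABRO.nonneg [NeZero m] {r : (Fin n → ℝ) → (Fin m → ℝ) → ℝ} (hO : IsABRO U ψ r δ O) :
    0 ≤ δ := by
  obtain ⟨-, -, w, -, -, hw⟩ := hO _ State.uniform_mem 0 1 ⟨by norm_num, le_rfl⟩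
  linarith [(norm_nonneg _).trans hw]

theorem logParam_le (hρ : 0 < ρ) (h : ρ ≤ n * opNormInf A) {K : ℕ}
    (hn : (n : ℝ) ≤ ((m : ℝ) + 1) ^ K) (hR : R ≤ ((m : ℝ) + 1) ^ K)
    (hA : opNormInf A ≤ ((m : ℝ) + 1) ^ K * ρ) :
    logParam A ρ R ≤ (2 * K + 1) * (1 + Real.log m) := by
  obtain ⟨hm, hn0, hop⟩ := pos_of_le_mul_opNormInf hρ h
  have hξ := xiParam_pos hρ h
  have hm1 : (1 : ℝ) ≤ m := by exact_mod_cast hm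
  have hξ1 : xiParam A ρ ≤ 1 := min_le_left _ _
  have hpow : (1 : ℝ) ≤ ((m : ℝ) + 1) ^ K := one_le_pow₀ (by linarith)
  have hmax : max (1 / xiParam A ρ) (R + xiParam A ρ) ≤ ((m : ℝ) + 1) ^ (2 * K + 1) := by
    refine max_le ?_ ?_
    · rw [xiParam_eq hρ h, one_div, inv_div, div_le_iff₀ hρ]
      calc (n : ℝ) * m * opNormInf A
          ≤ ((m : ℝ) + 1) ^ K * (m + 1) * (((m : ℝ) + 1) ^ K * ρ) := by
            gcongr
            linarith
        _ = _ := by ring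
    · calc R + xiParam A ρ ≤ 1 * (((m : ℝ) + 1) ^ K * 2) := by linarith
        _ ≤ ((m : ℝ) + 1) ^ K * (((m : ℝ) + 1) ^ K * (m + 1)) := by
            gcongr
            linarith
        _ = _ := by ring
  have hlog : Real.log ((m : ℝ) + 1) ≤ 1 + Real.log m := by
    calc Real.log ((m : ℝ) + 1) ≤ Real.log (2 * m) := Real.log_le_log (by linarith) (by linarith)
      _ = Real.log 2 + Real.log m := Real.log_mul two_ne_zero (by linarith)
      _ ≤ _ := by linarith [Real.log_two_lt_d9]
  calc logParam A ρ R ≤ Real.log (((m : ℝ) + 1) ^ (2 * K + 1)) :=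
        Real.log_le_log (lt_max_of_lt_left (by positivity)) hmax
    _ = (2 * K + 1) * Real.log ((m : ℝ) + 1) := by rw [Real.log_pow]; push_cast; ring
    _ ≤ _ := by gcongr

theorem isSubpolynomial_log_mul_log (C D : ℝ) :
    IsSubpolynomial fun m => C * (1 + Real.log m) * (1 + D * (1 + Real.log m)) := by
  intro θ hθ
  have h1 : (fun _ : ℕ => (1 : ℝ)) =O[Filter.atTop] fun m : ℕ => (m : ℝ) ^ (θ / 2) := by
    refine Asymptotics.IsBigO.of_bound 1 ?_
    filter_upwards [Filter.eventually_ge_atTop 1] with m hm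
    have : (1 : ℝ) ≤ (m : ℝ) ^ (θ / 2) :=
      Real.one_le_rpow (by exact_mod_cast hm) (by positivity)
    rw [Real.norm_eq_abs, Real.norm_eq_abs, abs_one, one_mul]
    exact this.trans (le_abs_self _)
  have h2 : (fun m : ℕ => Real.log m) =O[Filter.atTop] fun m : ℕ => (m : ℝ) ^ (θ / 2) :=
    (isLittleO_log_rpow_atTop (half_pos hθ)).isBigO.comp_tendsto tendsto_natCast_atTop_atTop
  have h3 := h1.add h2
  have h4 := (h3.const_mul_left C).mul (h1.add (h3.const_mul_left D))
  refine h4.trans (Asymptotics.IsBigO.of_bound 1 ?_)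
  filter_upwards [Filter.eventually_ge_atTop 1] with m hm
  have hm0 : (0 : ℝ) < m := by exact_mod_cast hm
  rw [← Real.rpow_add hm0, add_halves, one_mul]

theorem Machine.ResourcesLE.mono {N N' : ℝ} (h : σ.ResourcesLE N) (hN : N ≤ N') :
    σ.ResourcesLE N' :=
  ⟨h.1.trans hN, h.2.1.trans hN, h.2.2.trans
    (mul_le_mul_of_nonneg_left hN (le_max_of_le_left (Nat.cast_nonneg m)))⟩

theorem resourcesLE_of_counts {N : ℕ} {L : ℝ} (hm : 0 < m) (hL : 1 ≤ L)
    (hN : (N : ℝ) ≤ 302 * L)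
    (harith : σ.arith = 24 + 12 * n + 12 * m + N * (2 + 12 * n + 15 * m))
    (hprod : σ.products = 4 + 4 * N) (hcalls : σ.queries.length = 1 + N) :
    σ.ResourcesLE (10000 * L) := by
  have hM : (1 : ℝ) ≤ max (m : ℝ) n := le_max_of_le_left (by exact_mod_cast hm)
  have hmM : (m : ℝ) ≤ max (m : ℝ) n := le_max_left _ _
  have hnM : (n : ℝ) ≤ max (m : ℝ) n := le_max_right _ _
  refine ⟨?_, ?_, ?_⟩
  · rw [Machine.calls, hcalls]; push_cast; linarith
  · rw [hprod]; push_cast; linarith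
  · rw [harith]
    push_cast
    generalize max (m : ℝ) n = M at *
    have hN0 : (0 : ℝ) ≤ N := Nat.cast_nonneg N
    calc (24 : ℝ) + 12 * n + 12 * m + N * (2 + 12 * n + 15 * m)
        ≤ 24 * M + 12 * M + 12 * M + N * (2 * M + 12 * M + 15 * M) := by gcongr <;> linarith
      _ = M * (48 + 29 * N) := by ring
      _ ≤ M * (10000 * L) := by gcongr; linarith

end BoxSimplex

end

open BoxSimplex in
theorem mainTheorem6 :
    ∃ (P : Prog) (C : ℝ) (f : ℕ → ℕ → ℝ), (∀ K, IsSubpolynomial (f K)) ∧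
      ∀ (m n : ℕ) (A : Matrix (Fin m) (Fin n) ℝ) (U : Set (Fin n → ℝ))
        (ψ : (Fin n → ℝ) → ℝ) (ρ R ε δ B : ℝ)
        (O : (Fin m → ℝ) → (Fin n → ℝ) → ℝ → (Fin n → ℝ)) (σ : Machine m n),
        (∀ u ∈ U, 0 ≤ u) → ConvexOn ℝ U ψ →
        0 < ρ → (∀ u ∈ U, ‖absM A *ᵥ u‖ ≤ ρ) → ρ ≤ n * opNormInf A →
        (∀ u ∈ U, ‖u‖ ≤ R) → 0 < ε →
        B = logParam A ρ R →
        IsABRO U ψ (doublyEntropic A (4 * ρ * B) (xiParam A ρ)) δ O →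
        σ = P.run A O (initial m n ρ R ε) →
        (σ.x 0 ∈ U ∧ σ.y 0 ∈ stdSimplex ℝ (Fin m) ∧
          ∀ u ∈ U, ∀ v ∈ stdSimplex ℝ (Fin m),
            v ⬝ᵥ (A *ᵥ σ.x 0) + ψ (σ.x 0) ≤ σ.y 0 ⬝ᵥ (A *ᵥ u) + ψ u + ε * ρ + 6 * δ) ∧
        (∀ q ∈ σ.queries, q.v ∈ stdSimplex ℝ (Fin m) ∧ q.c ∈ Set.Icc (1 / 2 : ℝ) 1 ∧
          ‖q.h‖ ≤ max (m * n * B) (2 * B + 3) * opNormInf A) ∧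
        σ.ResourcesLE (C * (1 + Real.log m) * (1 + B) * (B / ε + 1)) ∧
        (∀ K : ℕ, (n : ℝ) ≤ ((m : ℝ) + 1) ^ K → R ≤ ((m : ℝ) + 1) ^ K →
          opNormInf A ≤ ((m : ℝ) + 1) ^ K * ρ →
          σ.ResourcesLE (f K m * (B / ε + 1))) := by
  refine ⟨mainProg, 10000, fun K m => 10000 * (1 + Real.log m)
    * (1 + (2 * K + 1) * (1 + Real.log m)), fun K => isSubpolynomial_log_mul_log _ _, ?_⟩
  intro m n A U ψ ρ R ε δ B O σ hU hψ hρ hrow hρA hR hε hB hO hσ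
  obtain ⟨hm, hn, hop⟩ := pos_of_le_mul_opNormInf hρ hρA
  have : NeZero m := ⟨hm.ne'⟩
  have hb : Bounds A U ρ (xiParam A ρ) B := hB ▸ bounds_of_params hU hρ hrow hρA hR
  have hbr := hO.bestResponds fun u hu j => (hb.add_xi_pos hu j).ne'
  have hδ := hO.nonneg
  have hB0 := hb.nonneg_B
  have hlog : 0 ≤ Real.log m := Real.log_natCast_nonneg m
  obtain ⟨a, ha⟩ : ∃ a, a = 120 * ρ * (1 + B) ^ 2 := ⟨_, rfl⟩
  have hapos : 0 < a := by rw [ha]; positivity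
  have hval := State.valid_iter (a := a) hbr hapos.ne'
  obtain ⟨hx, hy, harith, hprod, hcalls, hq⟩ := run_mainProg (A := A) (O := O)
    (good := fun q => q.v ∈ stdSimplex ℝ (Fin m) ∧ q.c ∈ Set.Icc (1 / 2 : ℝ) 1 ∧
      ‖q.h‖ ≤ max (m * n * B) (2 * B + 3) * opNormInf A) ρ R ε rfl hB ha
    ⟨State.uniform_mem, ⟨by norm_num, le_rfl⟩, by
      rw [norm_zero]
      exact mul_nonneg (le_max_of_le_right (by linarith)) hop.le⟩
    fun t => ⟨softmax_mem _, ⟨by norm_num, le_rfl⟩, (State.norm_nextH_le hb (hval t)).trans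
      (mul_le_mul_of_nonneg_right (le_max_right _ _) hop.le)⟩
  rw [← hσ] at hx hy harith hprod hcalls hq
  set N := ⌈300 * (B * ((1 + B) * (1 + Real.log m))) / ε + 1⌉₊ with hNdef
  have hX : 0 ≤ 300 * (B * ((1 + B) * (1 + Real.log m))) / ε := by positivity
  have hNge : 300 * (B * ((1 + B) * (1 + Real.log m))) / ε + 1 ≤ N := Nat.le_ceil _
  have hNlt : (N : ℝ) < 300 * (B * ((1 + B) * (1 + Real.log m))) / ε + 1 + 1 :=
    Nat.ceil_lt_add_one (by linarith)
  have hNpos : 0 < N := by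
    have : (0 : ℝ) < N := by linarith
    exact_mod_cast this
  obtain ⟨g1, g2, g3⟩ := State.average_gap_le hb hbr hψ ha hNpos
  rw [← hx] at g1 g3
  rw [← hy] at g2 g3
  have hL1 : 1 ≤ (1 + Real.log m) * (1 + B) := by nlinarith [mul_nonneg hlog hB0]
  have hBε : 0 ≤ B / ε := by positivity
  have hL : 1 ≤ (1 + Real.log m) * (1 + B) * (B / ε + 1) := by
    nlinarith [mul_nonneg (zero_le_one.trans hL1) hBε]
  have hNL : (N : ℝ) ≤ 302 * ((1 + Real.log m) * (1 + B) * (B / ε + 1)) := by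
    have h1 : 300 * (B * ((1 + B) * (1 + Real.log m))) / ε
        = 300 * ((1 + Real.log m) * (1 + B) * (B / ε)) := by ring
    have h2 : 0 ≤ (1 + Real.log m) * (1 + B) * (B / ε) := by positivity
    linarith
  have hres := resourcesLE_of_counts hm hL hNL harith hprod hcalls
  refine ⟨⟨g1, g2, fun u hu v hv => ?_⟩, hq, hres.mono (by linarith), ?_⟩
  · have h1 := g3 u hu v hv
    have h2 : 300 * ρ * (B * (1 + B) * (1 + Real.log m)) / N ≤ ε * ρ := by
      rw [div_le_iff₀ (by exact_mod_cast hNpos)]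
      have h3 : 300 * (B * ((1 + B) * (1 + Real.log m))) ≤ N * ε := by
        rw [← div_le_iff₀ hε]; linarith
      have := mul_le_mul_of_nonneg_left h3 hρ.le
      linarith
    linarith
  · intro K hnK hRK hAK
    have hle := logParam_le hρ hρA hnK hRK hAK
    rw [← hB] at hle
    refine hres.mono ?_
    calc 10000 * ((1 + Real.log m) * (1 + B) * (B / ε + 1))
        = 10000 * (1 + Real.log m) * (1 + B) * (B / ε + 1) := by ring
      _ ≤ 10000 * (1 + Real.log m) * (1 + (2 * K + 1) * (1 + Real.log m)) * (B / ε + 1) := by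
        gcongr
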